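/- **Regularity Characterization Theorem.** Let $G$ be a connected (finite-dimensional, real, Hausdorff) Lie group with Lie algebra $\mathfrak g$, and let $h \in \mathfrak g$ be an Euler element, i.e. $\mathrm{ad}\, h$ is non-zero and diagonalizable with eigenvalues in $\{-1,0,1\}$. Assume that the involution $e^{\pi i\, \mathrm{ad}\, h}$ of $\mathfrak g$ is the differential of an involutive automorphism $\tau_h$ of $G$, and put $G_{\tau_h} = G \rtimes \{\mathrm{id}_G, \tau_h\}$. Let $(U,\mathcal H)$ be an antiunitary representation of $G_{\tau_h}$ on a complex Hilbert space: a strongly continuous homomorphism into the group of unitary or antiunitary operators for which $U(G)$ consists of unitary operators and $J := U(\tau_h)$ is antiunitary. Let $\partial U(h)$ be the skew-adjoint generator of the unitary one-parameter group $t \mapsto U(\exp th)$, and let $$ V = V(h,U) = \mathrm{Fix}\big(J\, e^{\pi i\, \partial U(h)}\big) = \{ v \in \mathcal D(e^{\pi i\,\partial U(h)}) : J e^{\pi i\,\partial U(h)} v = v\} $$ be the corresponding standard subspace, i.e. the one with modular operator $\Delta_V = e^{2\pi i\, \partial U(h)}$ and modular conjugation $J_V = J$. A closed real subspace $E \subseteq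 \mathcal H$ is called cyclic if $E + iE$ is dense, and standard if in addition $E \cap iE = \{0\}$; the modular operator of a standard subspace $E$ is $\Delta_E = T_E^* T_E$, where $T_E(a+ib) = a - ib$ for $a,b \in E$. A net on $G$ assigns to every open subset $\mathcal O \subseteq G$ a closed real subspace $\mathsf H(\mathcal O) \subseteq \mathcal H$. Consider the properties - (Iso) $\mathcal O_1 \subseteq \mathcal O_2$ implies $\mathsf H(\mathcal O_1) \subseteq \mathsf H(\mathcal O_2)$; - (Cov) $U(g)\mathsf H(\mathcal O) = \mathsf H(g\mathcal O)$ for all $g \in G$ and all open $\mathcal O \subseteq G$; - (RS) $\mathsf H(\mathcal O)$ is cyclic for every non-empty open $\mathcal O \subseteq G$; - (BW) for an open connected subset $W \subseteq G$: $\mathsf H(W)$ is standard and $\Delta_{\mathsf H(W)} = e^{2\pi i\, \partial U(h)}$. Then the following are equivalent: 1. There is a net on the open subsets of $G$ satisfying (Iso), (Cov), (RS), and (BW) for some open connected subset $W \subseteq G$. 2. There is a net on the open subsets of $G$ satisfying (Iso), (Cov), (RS), and $\mathsf H(W) = V$ for some open connected subset $W \subseteq G$. 3. $U$ is $h$-regular,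 i.e. there is a neighborhood $N$ of the identity in $G$ such that $V_N = \bigcap_{g \in N} U(g)V$ is cyclic. (Connected sets are understood to be non-empty.) -/

import Mathlib

open Set TopologicalSpace
open scoped Manifold ContDiff InnerProductSpace

set_option linter.unusedSectionVars false

noncomputable section

/-! ### Lie groups, Euler elements and the involution `τ_h` -/

section EulerElement

variable {L : Type*} [LieRing L] [LieAlgebra ℝ L]

/-- `h` is an Euler element: `ad h` is non-zero and diagonalizable with eigenvalues in
`{-1, 0, 1}`, i.e. `𝔤 = 𝔤₁(h) + 𝔤₀(h) + 𝔤₋₁(h)`. -/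
def IsEulerElement (h : L) : Prop :=
  LieAlgebra.ad ℝ L h ≠ 0 ∧
    Module.End.eigenspace (LieAlgebra.ad ℝ L h) 1 ⊔
      Module.End.eigenspace (LieAlgebra.ad ℝ L h) 0 ⊔
      Module.End.eigenspace (LieAlgebra.ad ℝ L h) (-1) = ⊤

/-- The involution `e^{π i ad h}` of the Lie algebra defined by an Euler element `h`.
It acts on `𝔤_k(h)`, `k ∈ {-1, 0, 1}`, by the scalar `e^{π i k} = 1 - 2 k ^ 2`, so that
`e^{π i ad h} = 1 - 2 (ad h) ^ 2`; see `eulerInvolution_apply`. -/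
def eulerInvolution (h : L) : L →ₗ[ℝ] L :=
  LinearMap.id - (2 : ℝ) • (LieAlgebra.ad ℝ L h ∘ₗ LieAlgebra.ad ℝ L h)

/-- On `𝔤_k(h)`, `k ∈ {-1, 0, 1}`, the involution acts by the (real) scalar `e^{π i k}`. -/
theorem eulerInvolution_apply {h x : L} {k : ℝ} (hk : k = -1 ∨ k = 0 ∨ k = 1)
    (hx : ⁅h, x⁆ = k • x) :
    ∃ c : ℝ, (c : ℂ) = Complex.exp (Real.pi * Complex.I * k) ∧ eulerInvolution h x = c • x := by
  have e1 : eulerInvolution h x = (1 - 2 * k ^ 2) • x := by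
    simp only [eulerInvolution, LinearMap.sub_apply, LinearMap.id_apply, LinearMap.smul_apply,
      LinearMap.comp_apply, LieAlgebra.ad_apply, hx, lie_smul, sub_smul, one_smul, smul_smul]
    congr 2
    ring
  refine ⟨1 - 2 * k ^ 2, ?_, e1⟩
  rcases hk with rfl | rfl | rfl
  · simp [Complex.exp_neg, Complex.exp_pi_mul_I]; norm_num
  · simp
  · simp [Complex.exp_pi_mul_I]; norm_num

end EulerElement

section LieGroup

variable {E : Type*} [NormedAddCommGroup E] [NormedSpace ℝ E] [FiniteDimensional ℝ E]
  {G : Type*} [TopologicalSpace G] [ChartedSpace E G] [Group G] [LieGroup 𝓘(ℝ, E) ∞ G]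

instance : LieGroup 𝓘(ℝ, E) (minSmoothness ℝ 3) G := by
  rw [minSmoothness_of_isRCLikeNormedField]
  infer_instance

instance : CompleteSpace E := FiniteDimensional.complete ℝ E

variable [T2Space G]

/-- Left translates of integral curves of a left invariant vector field are integral curves. -/
theorem IsMIntegralCurveOn.mul_left_invariant {x : GroupLieAlgebra 𝓘(ℝ, E) G} {γ : ℝ → G}
    {s : Set ℝ} (hγ : IsMIntegralCurveOn (I := 𝓘(ℝ, E)) γ (mulInvariantVectorField x) s) (g : G) :
    IsMIntegralCurveOn (I := 𝓘(ℝ, E)) (fun t => g * γ t) (mulInvariantVectorField x) s := by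
  intro t ht
  have hd : ∀ a b : G, MDifferentiableAt 𝓘(ℝ, E) 𝓘(ℝ, E) (fun y : G => a * y) b := fun a b =>
    (contMDiff_mul_left (I := 𝓘(ℝ, E)) (n := ∞) (a := a)).mdifferentiableAt (by simp)
  have h1 := (hd g (γ t)).hasMFDerivAt.comp_hasMFDerivWithinAt t (hγ t ht)
  have h2 : mulInvariantVectorField x (g * γ t) =
      mfderiv 𝓘(ℝ, E) 𝓘(ℝ, E) (fun y => g * y) (γ t) (mulInvariantVectorField x (γ t)) := by
    have hA : ∀ b : G, b = γ t → HasMFDerivAt 𝓘(ℝ, E) 𝓘(ℝ, E) (fun y : G => g * y) b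
        (mfderiv 𝓘(ℝ, E) 𝓘(ℝ, E) (fun y : G => g * y) (γ t) : E →L[ℝ] E) := by
      rintro b rfl
      exact (hd g (γ t)).hasMFDerivAt
    have hB := (hA (γ t * 1) (mul_one _)).comp (1 : G) (hd (γ t) 1).hasMFDerivAt
    have hC : (fun y => g * y) ∘ (fun y => γ t * y) = (fun y => g * γ t * y) := by
      funext y; simp [mul_assoc]
    rw [hC] at hB
    exact congrArg (fun f : E →L[ℝ] E => f x) hB.mfderiv
  rw [h2]
  have h3 : ∀ (A : E →L[ℝ] E) (w : E), A.comp ((1 : ℝ →L[ℝ] ℝ).smulRight w) =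
      (1 : ℝ →L[ℝ] ℝ).smulRight (A w) := by
    intro A w
    ext
    simp
  exact (h3 _ _) ▸ h1

/-- Left invariant vector fields on a Lie group are complete. -/
theorem exists_oneParam (x : GroupLieAlgebra 𝓘(ℝ, E) G) :
    ∃ γ : ℝ → G, γ 0 = 1 ∧ IsMIntegralCurve (I := 𝓘(ℝ, E)) γ (mulInvariantVectorField x) := by
  have hv : ContMDiff 𝓘(ℝ, E) 𝓘(ℝ, E).tangent 1
      (fun g : G => (⟨g, mulInvariantVectorField x g⟩ : TangentBundle 𝓘(ℝ, E) G)) := by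
    refine (contMDiff_mulInvariantVectorField x).of_le ?_
    rw [minSmoothness_of_isRCLikeNormedField]
    norm_num
  obtain ⟨γ, h0, hγ⟩ := exists_isMIntegralCurveAt_of_contMDiffAt_boundaryless (t₀ := 0)
    (hv.contMDiffAt (x := (1 : G)))
  obtain ⟨ε, hε, hγ⟩ := isMIntegralCurveAt_iff'.1 hγ
  refine exists_isMIntegralCurve_of_isMIntegralCurveOn hv hε (fun g => ?_) 1
  refine ⟨fun t => g * γ t, by simp [h0], ?_⟩
  have := hγ.mul_left_invariant g
  rwa [Real.ball_eq_Ioo, zero_sub, zero_add] at this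

/-- The curve `t ↦ exp (t x)`: the integral curve through the identity of the left invariant
vector field defined by `x`. -/
def expCurve (x : GroupLieAlgebra 𝓘(ℝ, E) G) : ℝ → G := (exists_oneParam x).choose

/-- `σ` is an involutive automorphism of the Lie group `G` whose differential is
`e^{π i ad h}`. -/
structure IntegratesEulerInvolution (h : GroupLieAlgebra 𝓘(ℝ, E) G) (σ : MulAut G) : Prop where
  contMDiff : ContMDiff 𝓘(ℝ, E) 𝓘(ℝ, E) ∞ σ
  involutive : ∀ g, σ (σ g) = g
  mfderiv_eq : ∀ x : GroupLieAlgebra 𝓘(ℝ, E) G,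
    (mfderiv 𝓘(ℝ, E) 𝓘(ℝ, E) σ (1 : G) x : E) = eulerInvolution h x

end LieGroup

/-! ### Real subspaces of a complex Hilbert space and their modular operators -/

section RealSubspace

variable {H : Type*} [NormedAddCommGroup H] [InnerProductSpace ℂ H]

/-- A real subspace `V` is cyclic if `V + i V` is dense. -/
def IsCyclicSubspace (V : Submodule ℝ H) : Prop :=
  Dense {x : H | ∃ a ∈ V, ∃ b ∈ V, x = a + Complex.I • b}

/-- A real subspace `V` is separating if `V ∩ i V = {0}`. -/
def IsSeparatingSubspace (V : Submodule ℝ H) : Prop :=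
  ∀ v ∈ V, ∀ w ∈ V, v = Complex.I • w → v = 0

/-- A standard subspace: a closed real subspace that is cyclic and separating. -/
def IsStandardSubspace (V : Submodule ℝ H) : Prop :=
  IsClosed (V : Set H) ∧ IsCyclicSubspace V ∧ IsSeparatingSubspace V

/-- This is the same notion as Mathlib's bundled one. -/
theorem isStandardSubspace_iff (V : Submodule ℝ H) :
    IsStandardSubspace V ↔ ∃ S : StandardSubspace H, S.toClosedSubmodule.toSubmodule = V := by
  have key : ∀ S : ClosedSubmodule ℝ H,
      (S ⊔ S.mulI = ⊤ ↔ IsCyclicSubspace S.toSubmodule) ∧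
      (S ⊓ S.mulI = ⊥ ↔ IsSeparatingSubspace S.toSubmodule) := by
    intro S
    have hmem : ∀ x : H, x ∈ S.mulI ↔ ∃ b ∈ S, x = Complex.I • b := by
      intro x
      rw [ClosedSubmodule.mem_mapEquiv_iff]
      constructor
      · intro hx
        refine ⟨_, hx, ?_⟩
        simp [Units.smul_def, smul_smul]
      · rintro ⟨b, hb, rfl⟩
        simpa [Units.smul_def, smul_smul] using hb
    constructor
    · have hset : ((S.toSubmodule ⊔ S.mulI.toSubmodule : Submodule ℝ H) : Set H) =
          {x : H | ∃ a ∈ S.toSubmodule, ∃ b ∈ S.toSubmodule, x = a + Complex.I • b} := by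
        ext x
        simp only [SetLike.mem_coe, Submodule.mem_sup, ClosedSubmodule.mem_toSubmodule_iff, hmem,
          Set.mem_ofPred_eq]
        constructor
        · rintro ⟨a, ha, _, ⟨b, hb, rfl⟩, rfl⟩
          exact ⟨a, ha, b, hb, rfl⟩
        · rintro ⟨a, ha, b, hb, rfl⟩
          exact ⟨a, ha, _, ⟨b, hb, rfl⟩, rfl⟩
      rw [IsCyclicSubspace, ← hset, Submodule.dense_iff_topologicalClosure_eq_top]
      exact ClosedSubmodule.toSubmodule_injective.eq_iff.symm
    · constructor
      · rintro h v hv w hw rfl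
        have : Complex.I • w ∈ S ⊓ S.mulI := ⟨hv, (hmem _).2 ⟨w, hw, rfl⟩⟩
        rw [h] at this
        exact this
      · intro h
        refine le_antisymm (fun v hv => ?_) bot_le
        obtain ⟨b, hb, hvb⟩ := (hmem v).1 hv.2
        exact h v hv.1 b hb hvb
  constructor
  · rintro ⟨h1, h2, h3⟩
    exact ⟨⟨⟨V, h1⟩, (key ⟨V, h1⟩).2.2 h3, (key ⟨V, h1⟩).1.2 h2⟩, rfl⟩
  · rintro ⟨S, rfl⟩
    exact ⟨S.toClosedSubmodule.isClosed, (key _).1.1 S.IsCyclic, (key _).2.1 S.IsSeparating⟩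

/-- The graph of the Tomita operator `T_V : V + i V → H`, `T_V (a + i b) = a - i b`. -/
def tomitaGraph (V : Submodule ℝ H) : Set (H × H) :=
  {p | ∃ a ∈ V, ∃ b ∈ V, p.1 = a + Complex.I • b ∧ p.2 = a - Complex.I • b}

/-- The graph of the adjoint `T*` of an antilinear operator with graph `T`:
`⟪T* η, ξ⟫ = ⟪T ξ, η⟫` for all `ξ` in the domain of `T`. -/
def antilinearAdjointGraph (T : Set (H × H)) : Set (H × H) :=
  {p | ∀ q ∈ T, ⟪p.2, q.1⟫_ℂ = ⟪q.2, p.1⟫_ℂ}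

/-- The graph of the modular operator `Δ_V = T_V* T_V`. -/
def modularOperatorGraph (V : Submodule ℝ H) : Set (H × H) :=
  {p | ∃ η : H, (p.1, η) ∈ tomitaGraph V ∧ (η, p.2) ∈ antilinearAdjointGraph (tomitaGraph V)}

/-- `F` is continuous on the closed strip `0 ≤ Im z ≤ β`, holomorphic in its interior, and extends
the function `f` on the real line. -/
structure IsStripExtension (f : ℝ → H) (β : ℝ) (F : ℂ → H) : Prop where
  continuousOn : ContinuousOn F {z : ℂ | 0 ≤ z.im ∧ z.im ≤ β}
  differentiableOn : DifferentiableOn ℂ F {z : ℂ | 0 < z.im ∧ z.im < β}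
  eq_ofReal : ∀ t : ℝ, F t = f t

/-- For a strongly continuous one-parameter group `u t = e^{t A}` of unitary operators, `A` its
skew-adjoint generator, and `β ≥ 0`, the graph of the (in general unbounded) positive selfadjoint
operator `e^{i β A}`: a vector `v` lies in its domain if and only if its orbit map `t ↦ e^{t A} v`
extends analytically to the strip `0 ≤ Im z ≤ β`, and then `e^{i β A} v` is the value of the
extension at `i β`. -/
def imaginaryExpGraph (u : ℝ → H ≃ₗᵢ[ℝ] H) (β : ℝ) : Set (H × H) :=
  {p | ∃ F : ℂ → H, IsStripExtension (fun t => u t p.1) β F ∧ F (β * Complex.I) = p.2}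

end RealSubspace

/-! ### Antiunitary representations and nets of real subspaces -/

/-- For an involutive automorphism `σ` of `G`, the group `G_σ = G ⋊ {id, σ}`. -/
abbrev InvolutiveExtension {G : Type*} [Group G] (σ : MulAut G) : Type _ :=
  G ⋊[(Subgroup.zpowers σ).subtype] (Subgroup.zpowers σ)

/-- An antiunitary representation of `G_σ` on the complex Hilbert space `H`: a strongly continuous
homomorphism into the group of unitary or antiunitary operators, such that `G` acts by unitary
operators and `σ` acts by an antiunitary one. (A surjective real linear isometry is unitary if it
is complex linear, and antiunitary if it is antilinear; as `G_σ` is generated by `G` and `σ`, all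
its elements act by operators of these two kinds.) -/
structure AntiunitaryRep {G : Type*} [Group G] [TopologicalSpace G] (σ : MulAut G)
    (H : Type*) [NormedAddCommGroup H] [InnerProductSpace ℂ H] where
  toHom : InvolutiveExtension σ →* (H ≃ₗᵢ[ℝ] H)
  map_smul_inl : ∀ (g : G) (c : ℂ) (v : H),
    toHom (SemidirectProduct.inl g) (c • v) = c • toHom (SemidirectProduct.inl g) v
  map_smul_inr : ∀ (c : ℂ) (v : H),
    toHom (SemidirectProduct.inr ⟨σ, Subgroup.mem_zpowers σ⟩) (c • v) =
      (starRingEnd ℂ) c • toHom (SemidirectProduct.inr ⟨σ, Subgroup.mem_zpowers σ⟩) v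
  continuous_orbit : ∀ v : H, Continuous fun g : G => toHom (SemidirectProduct.inl g) v

namespace AntiunitaryRep

section Basic

variable {G : Type*} [Group G] [TopologicalSpace G] {σ : MulAut G}
  {H : Type*} [NormedAddCommGroup H] [InnerProductSpace ℂ H]

/-- The unitary operator `U(g)`, `g ∈ G`. -/
def op (U : AntiunitaryRep σ H) (g : G) : H ≃ₗᵢ[ℝ] H := U.toHom (SemidirectProduct.inl g)

/-- The conjugation `J = U(σ)`. -/
def conj (U : AntiunitaryRep σ H) : H ≃ₗᵢ[ℝ] H :=
  U.toHom (SemidirectProduct.inr ⟨σ, Subgroup.mem_zpowers σ⟩)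

/-- The real subspace `U(g) V`. -/
def translate (U : AntiunitaryRep σ H) (g : G) (V : Submodule ℝ H) : Submodule ℝ H :=
  V.map ((U.op g).toLinearEquiv : H →ₗ[ℝ] H)

end Basic

section Lie

variable {E : Type*} [NormedAddCommGroup E] [NormedSpace ℝ E] [FiniteDimensional ℝ E]
  {G : Type*} [TopologicalSpace G] [ChartedSpace E G] [Group G] [LieGroup 𝓘(ℝ, E) ∞ G]
  [T2Space G] {σ : MulAut G} {H : Type*} [NormedAddCommGroup H] [InnerProductSpace ℂ H]

/-- The graph of the operator `e^{i β ∂U(h)}`, where `∂U(h)` is the skew-adjoint generator of the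
unitary one-parameter group `t ↦ U(exp (t h))`. -/
def expGraph (U : AntiunitaryRep σ H) (h : GroupLieAlgebra 𝓘(ℝ, E) G) (β : ℝ) : Set (H × H) :=
  imaginaryExpGraph (fun t => U.op (expCurve h t)) β

/-- The subspace `V(h, U) = Fix (J Δ^{1/2})` with `J = U(σ)` and `Δ^{1/2} = e^{i π ∂U(h)}`. As `J` is
an involution, `J Δ^{1/2} v = v` means `Δ^{1/2} v = J v`. -/
def standardSubspace (U : AntiunitaryRep σ H) (h : GroupLieAlgebra 𝓘(ℝ, E) G) :
    Submodule ℝ H where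
  carrier := {v | (v, U.conj v) ∈ U.expGraph h Real.pi}
  zero_mem' := ⟨fun _ => 0, ⟨continuousOn_const, differentiableOn_const _, by simp⟩, by simp⟩
  add_mem' := by
    rintro v w ⟨F, hF, hF'⟩ ⟨K, hK, hK'⟩
    exact ⟨fun z => F z + K z, ⟨hF.continuousOn.add hK.continuousOn,
      hF.differentiableOn.add hK.differentiableOn,
      fun t => by simp [hF.eq_ofReal, hK.eq_ofReal]⟩, by simp [hF', hK']⟩
  smul_mem' := by
    rintro c v ⟨F, hF, hF'⟩
    exact ⟨fun z => c • F z, ⟨hF.continuousOn.const_smul c, hF.differentiableOn.const_smul c,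
      fun t => by simp [hF.eq_ofReal]⟩, by simp [hF']⟩

/-- `U` is `h`-regular: `V_N = ⋂_{g ∈ N} U(g) V` is cyclic for some identity neighborhood `N`. -/
def IsRegular (U : AntiunitaryRep σ H) (h : GroupLieAlgebra 𝓘(ℝ, E) G) : Prop :=
  ∃ N ∈ nhds (1 : G), IsCyclicSubspace (⨅ g ∈ N, U.translate g (U.standardSubspace h))

end Lie

end AntiunitaryRep

section Net

variable {G : Type*} [Group G] [TopologicalSpace G] {σ : MulAut G}
  {H : Type*} [NormedAddCommGroup H] [InnerProductSpace ℂ H]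

/-- A net of closed real subspaces on the open subsets of `G`. -/
abbrev RealNet (G H : Type*) [TopologicalSpace G] [NormedAddCommGroup H] [InnerProductSpace ℂ H] :
    Type _ :=
  Opens G → ClosedSubmodule ℝ H

namespace RealNet

/-- (Iso) `O₁ ⊆ O₂` implies `𝖧(O₁) ⊆ 𝖧(O₂)`. -/
def Isotone (N : RealNet G H) : Prop :=
  ∀ O₁ O₂ : Opens G, O₁ ≤ O₂ → N O₁ ≤ N O₂

/-- (Cov) `U(g) 𝖧(O) = 𝖧(g O)`; here `O'` is the open set `g O`. -/
def Covariant (N : RealNet G H) (U : AntiunitaryRep σ H) : Prop :=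
  ∀ (g : G) (O O' : Opens G), (O' : Set G) = (fun x => g * x) '' (O : Set G) →
    U.translate g (N O).toSubmodule = (N O').toSubmodule

/-- (RS) `𝖧(O)` is cyclic for every non-empty open set `O`. -/
def ReehSchlieder (N : RealNet G H) : Prop :=
  ∀ O : Opens G, (O : Set G).Nonempty → IsCyclicSubspace (N O).toSubmodule

/-- (BW) for `h` and the open connected set `W`: `𝖧(W)` is standard, and its modular operator is
`e^{2 π i ∂U(h)}`. -/
def BisognanoWichmann {E : Type*} [NormedAddCommGroup E] [NormedSpace ℝ E] [FiniteDimensional ℝ E]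
    [ChartedSpace E G] [LieGroup 𝓘(ℝ, E) ∞ G] [T2Space G]
    (N : RealNet G H) (U : AntiunitaryRep σ H) (h : GroupLieAlgebra 𝓘(ℝ, E) G) (W : Opens G) :
    Prop :=
  IsConnected (W : Set G) ∧ IsStandardSubspace (N W).toSubmodule ∧
    modularOperatorGraph (N W).toSubmodule = U.expGraph h (2 * Real.pi)

end RealNet

end Net

end

/-! Write A = ∂U(h) and S = J e^{πiA}, so that V = Fix(S) and S is the Tomita operator of V.

From (BW) to regularity: for a small open O and g near the identity, g⁻¹O ⊆ W, so (Iso), (Cov) and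
(RS) make the intersection of the U(g)H(W), g near 1, cyclic. H(W) need not equal V, since (BW) does
not fix its conjugation; but a standard subspace with modular operator e^{2πiA} lies in the domain
of the square root e^{πiA}, because the domain of T*T is a core for T (`closure_tomitaCore`,
`IsUnitaryOneParam.exists_mem_imaginaryExpGraph`). So the intersection consists of vectors v whose
translates U(g⁻¹)v all lie in the domain of S. If [h,x] = kx, then U(exp th)U(exp sx) = U(exp
se^{kt}x)U(exp th). Continuation to t = πi replaces e^{kt} by (-1)^k, which is also how τ acts on
exp ℝx (`imaginaryExpGraph_intertwine`). Eigenvectors span the Lie algebra and products of their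
one-parameter groups fill an identity neighborhood, so S commutes with U(g) on such v for g near 1
(`eventually_op_mem_expGraph`). Hence v = (v+Sv)/2 + i(v-Sv)/(2i) has both components in some V_N,
and V_N is cyclic.

From regularity to a net: attach translates of V_N to points and translates of V to translates of W,
and take closed spans. If W is a small neighborhood of 1, the first kind contributes only vectors of
V to H(W), and the second only V itself: gW ⊆ W puts all powers of g in W, so g = 1, as a Lie group
has no small subgroups. Finally, V is separating with modular operator e^{2πiA}, which gives (BW)
when H(W) = V.

The unbounded operators e^{iβA} are handled through analytic continuation of orbit maps instead of
spectral calculus. Gaussian regularization (`mollify`) supplies entire vectors and turns membership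
in the graph into identities between bounded operators (`mem_imaginaryExpGraph_iff`). -/

/-! ### Uniqueness of holomorphic functions on a strip with given values on the real line -/

section Strip

open Filter Topology Complex

/-- A function on a strip, holomorphic inside, continuous and zero on the real line, vanishes close
to the real line: multiply its four rotates around the centre of a square with one side on `ℝ`. -/
theorem eq_zero_of_strip_lower {β : ℝ} {f : ℂ → ℂ}
    (hc : ContinuousOn f {z : ℂ | 0 ≤ z.im ∧ z.im ≤ β})
    (hd : DifferentiableOn ℂ f {z : ℂ | 0 < z.im ∧ z.im < β}) (h0 : ∀ t : ℝ, f t = 0)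
    {p : ℂ} (hp : 0 < p.im) (hp' : 2 * p.im < β) : f p = 0 := by
  set r := p.im with hr
  set Q : Set ℂ := {z | |(z - p).re| < r ∧ |(z - p).im| < r}
  set Q' : Set ℂ := {z | |(z - p).re| ≤ r ∧ |(z - p).im| ≤ r}
  have hQQ' : closure Q ⊆ Q' := by
    refine closure_minimal (fun z hz => ⟨hz.1.le, hz.2.le⟩) ?_
    have h1 : Continuous fun z : ℂ => |(z - p).re| := by fun_prop
    have h2 : Continuous fun z : ℂ => |(z - p).im| := by fun_prop
    exact (isClosed_Iic.preimage h1).inter (isClosed_Iic.preimage h2)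
  have hQo : IsOpen Q := by
    have h1 : Continuous fun z : ℂ => |(z - p).re| := by fun_prop
    have h2 : Continuous fun z : ℂ => |(z - p).im| := by fun_prop
    exact (isOpen_Iio.preimage h1).inter (isOpen_Iio.preimage h2)
  have hQb : Bornology.IsBounded Q := by
    refine (Metric.isBounded_ball (x := p) (r := r + r)).subset fun z hz => ?_
    rw [Metric.mem_ball, dist_eq_norm]
    exact (Complex.norm_le_abs_re_add_abs_im _).trans_lt (add_lt_add hz.1 hz.2)
  have hfQ' : ∀ w : ℂ, w = 1 ∨ w = I ∨ w = -1 ∨ w = -I →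
      ∀ z ∈ Q', (0 ≤ (p + w * (z - p)).im ∧ (p + w * (z - p)).im ≤ β) := by
    rintro w hw z ⟨h1, h2⟩
    rw [abs_le] at h1 h2
    rcases hw with rfl | rfl | rfl | rfl <;> simp at h1 h2 ⊢ <;> constructor <;> linarith
  have hfQ : ∀ w : ℂ, w = 1 ∨ w = I ∨ w = -1 ∨ w = -I →
      ∀ z ∈ Q, (0 < (p + w * (z - p)).im ∧ (p + w * (z - p)).im < β) := by
    rintro w hw z ⟨h1, h2⟩
    rw [abs_lt] at h1 h2
    rcases hw with rfl | rfl | rfl | rfl <;> simp at h1 h2 ⊢ <;> constructor <;> linarith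
  have hdc : ∀ w : ℂ, w = 1 ∨ w = I ∨ w = -1 ∨ w = -I →
      DifferentiableOn ℂ (fun z => f (p + w * (z - p))) Q ∧
      ContinuousOn (fun z => f (p + w * (z - p))) (closure Q) := fun w hw =>
    ⟨hd.comp (by fun_prop) (hfQ w hw),
      hc.comp (by fun_prop) fun z hz => hfQ' w hw z (hQQ' hz)⟩
  have key := Complex.norm_le_of_forall_mem_frontier_norm_le (C := 0) (z := p) hQb
    (f := fun z => f (p + 1 * (z - p)) * f (p + I * (z - p)) * f (p + (-1) * (z - p)) *
      f (p + (-I) * (z - p)))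
    ⟨(((hdc 1 (by simp)).1.mul (hdc I (by simp)).1).mul (hdc (-1) (by simp)).1).mul
        (hdc (-I) (by simp)).1,
      (((hdc 1 (by simp)).2.mul (hdc I (by simp)).2).mul (hdc (-1) (by simp)).2).mul
        (hdc (-I) (by simp)).2⟩ ?_ (subset_closure (by simp [Q, hp]))
  · rw [norm_le_zero_iff] at key
    simpa using key
  · intro z hz
    have hz' : z ∈ Q' := hQQ' hz.1
    have hzn : z ∉ Q := by
      have := hz.2
      rwa [hQo.interior_eq] at this
    have hreal : ∀ w : ℂ, (p + w * (z - p)).im = 0 → f (p + w * (z - p)) = 0 := by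
      intro w hw
      rw [show p + w * (z - p) = (((p + w * (z - p)).re : ℝ) : ℂ) from Complex.ext rfl hw]
      exact h0 _
    have h4 : |(z - p).re| = r ∨ |(z - p).im| = r := by
      by_contra! hcon
      exact hzn ⟨lt_of_le_of_ne hz'.1 hcon.1, lt_of_le_of_ne hz'.2 hcon.2⟩
    rw [norm_le_zero_iff]
    -- Each side of the square is carried to the bottom side, which lies on ℝ, by one of the four
    -- rotations, so one factor vanishes.
    rcases h4 with h | h <;> rcases (abs_eq hp.le).1 h with h | h
    · rw [hreal (-I) (by simp at h ⊢; linarith)]; simp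
    · rw [hreal I (by simp at h ⊢; linarith)]; simp
    · rw [hreal (-1) (by simp at h ⊢; linarith)]; simp
    · rw [hreal 1 (by simp at h ⊢; linarith)]; simp

/-- The identity theorem spreads the vanishing near the real line over the open strip; continuity
along vertical segments adds the boundary. -/
theorem eq_zero_of_strip {β : ℝ} (hβ : 0 < β) {f : ℂ → ℂ}
    (hc : ContinuousOn f {z : ℂ | 0 ≤ z.im ∧ z.im ≤ β})
    (hd : DifferentiableOn ℂ f {z : ℂ | 0 < z.im ∧ z.im < β}) (h0 : ∀ t : ℝ, f t = 0)
    {z : ℂ} (hz : 0 ≤ z.im) (hz' : z.im ≤ β) : f z = 0 := by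
  have hopen : IsOpen {z : ℂ | 0 < z.im ∧ z.im < β} := isOpen_Ioo.preimage Complex.continuous_im
  have hconn : IsPreconnected {z : ℂ | 0 < z.im ∧ z.im < β} :=
    ((convex_halfSpace_im_gt 0).inter (convex_halfSpace_im_lt β)).isPreconnected
  -- Any height strictly between 0 and β/2 works: the square argument then applies on a whole
  -- neighborhood.
  have hmem : (((β / 4 : ℝ) : ℂ) * I) ∈ {z : ℂ | 0 < z.im ∧ z.im < β} := by
    constructor <;> simp <;> linarith
  have hEq : EqOn f 0 {z : ℂ | 0 < z.im ∧ z.im < β} := by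
    refine (hd.analyticOnNhd hopen).eqOn_zero_of_preconnected_of_eventuallyEq_zero hconn hmem ?_
    have hlow : {z : ℂ | 0 < z.im ∧ 2 * z.im < β} ∈ 𝓝 (((β / 4 : ℝ) : ℂ) * I) := by
      have h2 : Continuous fun z : ℂ => 2 * z.im := by fun_prop
      refine ((isOpen_Ioi.preimage Complex.continuous_im).inter
        (isOpen_Iio.preimage h2)).mem_nhds ?_
      constructor <;> simp <;> linarith
    filter_upwards [hlow] with w hw
    exact eq_zero_of_strip_lower hc hd h0 hw.1 hw.2
  set g : ℝ → ℂ := fun s => (z.re : ℂ) + (s : ℂ) * I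
  have hg : ContinuousOn (fun s => f (g s)) (Icc 0 β) := by
    refine hc.comp (by fun_prop) fun s hs => ?_
    simpa [g] using hs
  have h1 : EqOn (fun s => f (g s)) (fun _ => 0) (closure (Ioo 0 β)) := by
    refine EqOn.of_subset_closure (s := Ioo 0 β) (fun s hs => hEq ?_)
      (by rwa [closure_Ioo hβ.ne]) continuousOn_const subset_closure subset_rfl
    simpa [g] using hs
  have := h1 (x := z.im) (by rw [closure_Ioo hβ.ne]; exact ⟨hz, hz'⟩)
  simpa [g] using this

variable {H : Type*} [NormedAddCommGroup H] [InnerProductSpace ℂ H]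

/-- A continuous function on a closed strip, holomorphic inside, is determined by its values on the
real line. -/
theorem eq_of_strip {β : ℝ} (hβ : 0 < β) {F K : ℂ → H}
    (hcF : ContinuousOn F {z : ℂ | 0 ≤ z.im ∧ z.im ≤ β})
    (hdF : DifferentiableOn ℂ F {z : ℂ | 0 < z.im ∧ z.im < β})
    (hcK : ContinuousOn K {z : ℂ | 0 ≤ z.im ∧ z.im ≤ β})
    (hdK : DifferentiableOn ℂ K {z : ℂ | 0 < z.im ∧ z.im < β}) (h : ∀ t : ℝ, F t = K t)
    {z : ℂ} (hz : 0 ≤ z.im) (hz' : z.im ≤ β) : F z = K z := by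
  refine ext_inner_left ℂ fun v => ?_
  rw [← sub_eq_zero, ← inner_sub_right]
  refine eq_zero_of_strip (f := fun z => ⟪v, F z - K z⟫_ℂ) hβ ?_ ?_ ?_ hz hz'
  · exact (innerSL ℂ v).continuous.comp_continuousOn (hcF.sub hcK)
  · exact (innerSL ℂ v).differentiable.comp_differentiableOn (hdF.sub hdK)
  · intro t; simp [h]

/-- The composition of an antilinear map with a holomorphic function of `conj z` is holomorphic. -/
theorem DifferentiableAt.antilinear_comp_conj {X Y : Type*} [NormedAddCommGroup X]
    [NormedSpace ℂ X] [NormedAddCommGroup Y] [NormedSpace ℂ Y] (L : X →L⋆[ℂ] Y) {F : ℂ → X} {z : ℂ}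
    (hF : DifferentiableAt ℂ F (starRingEnd ℂ z)) :
    DifferentiableAt ℂ (fun w => L (F (starRingEnd ℂ w))) z := by
  have h := hF.hasDerivAt
  suffices HasDerivAt (fun w => L (F (starRingEnd ℂ w))) (L (deriv F (starRingEnd ℂ z))) z from
    this.differentiableAt
  rw [hasDerivAt_iff_tendsto_slope] at h ⊢
  have hconj : Tendsto (starRingEnd ℂ) (𝓝[≠] z) (𝓝[≠] (starRingEnd ℂ z)) := by
    refine tendsto_nhdsWithin_iff.2
      ⟨(Complex.continuous_conj.tendsto z).mono_left nhdsWithin_le_nhds, ?_⟩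
    filter_upwards [self_mem_nhdsWithin] with w hw
    exact fun he => hw ((starRingEnd ℂ).injective he)
  refine ((L.continuous.tendsto _).comp (h.comp hconj)).congr fun w => ?_
  simp [slope_def_module, ← map_sub, ← map_inv₀]

end Strip

/-! ### Gaussian regularization for unitary one-parameter groups -/

section GaussianKernel

open Filter Topology Complex MeasureTheory

/-- The Gaussian kernel of variance `1 / (2 (n + 1))`, as an entire function. -/
noncomputable def gaussKernel (n : ℕ) (z : ℂ) : ℂ :=
  (Real.sqrt ((n + 1) / Real.pi) : ℂ) * cexp (-(n + 1) * z ^ 2)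

theorem gaussKernel_neg (n : ℕ) (z : ℂ) : gaussKernel n (-z) = gaussKernel n z := by
  simp [gaussKernel]

theorem gaussKernel_conj (n : ℕ) (z : ℂ) :
    gaussKernel n (starRingEnd ℂ z) = starRingEnd ℂ (gaussKernel n z) := by
  simp [gaussKernel, ← Complex.exp_conj]

theorem continuous_gaussKernel (n : ℕ) : Continuous (gaussKernel n) := by
  unfold gaussKernel; fun_prop

theorem hasDerivAt_gaussKernel (n : ℕ) (z : ℂ) :
    HasDerivAt (gaussKernel n) (-2 * (n + 1) * z * gaussKernel n z) z := by
  have h := (((hasDerivAt_pow 2 z).const_mul (-(n + 1) : ℂ)).cexp).const_mul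
    (Real.sqrt ((n + 1) / Real.pi) : ℂ)
  refine h.congr_deriv ?_
  simp only [gaussKernel]
  push_cast
  ring

/-- With z = x + iy, the inequality (s - x)² ≥ s²/2 - x² bounds the kernel by one real Gaussian
uniformly for ‖z‖ ≤ R. This is the majorant for integrability and for differentiation under the
integral. -/
theorem norm_gaussKernel_sub_le (n : ℕ) {R : ℝ} {z : ℂ} (hz : ‖z‖ ≤ R) (s : ℝ) :
    ‖gaussKernel n (s - z)‖ ≤ (Real.sqrt ((n + 1) / Real.pi) * Real.exp ((n + 1) * R ^ 2)) *
      Real.exp (-((n + 1) / 2) * s ^ 2) := by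
  have hn : (0 : ℝ) ≤ n := n.cast_nonneg
  rw [gaussKernel, norm_mul, Complex.norm_real, Real.norm_of_nonneg (Real.sqrt_nonneg _),
    Complex.norm_exp, mul_assoc, ← Real.exp_add]
  gcongr
  have h1 : z.re ^ 2 + z.im ^ 2 ≤ R ^ 2 := by
    have := Complex.sq_norm z
    rw [Complex.normSq_apply] at this
    nlinarith [norm_nonneg z]
  have h2 : (-(n + 1 : ℂ) * ((s : ℂ) - z) ^ 2).re = -(n + 1) * ((s - z.re) ^ 2 - z.im ^ 2) := by
    have : (-(n + 1 : ℂ)) = ((-(n + 1) : ℝ) : ℂ) := by push_cast; ring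
    rw [this, Complex.re_ofReal_mul]
    simp [pow_two]
  rw [h2]
  nlinarith [sq_nonneg (s - 2 * z.re), mul_nonneg hn (sq_nonneg (s - 2 * z.re)),
    mul_nonneg hn (sub_nonneg.2 h1)]

theorem integrable_gaussKernel_sub (n : ℕ) (z : ℂ) :
    Integrable fun s : ℝ => gaussKernel n (s - z) := by
  refine Integrable.mono' ((integrable_exp_neg_mul_sq (b := ((n : ℝ) + 1) / 2)
    (by positivity)).const_mul _)
    ((continuous_gaussKernel n).comp (by fun_prop)).aestronglyMeasurable
    (ae_of_all _ (norm_gaussKernel_sub_le n le_rfl))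

end GaussianKernel

/-- A strongly continuous one-parameter group of unitary operators. -/
structure IsUnitaryOneParam {H : Type*} [NormedAddCommGroup H] [InnerProductSpace ℂ H]
    (u : ℝ → H ≃ₗᵢ[ℝ] H) : Prop where
  map_add : ∀ s t v, u (s + t) v = u s (u t v)
  map_smul : ∀ t (c : ℂ) v, u t (c • v) = c • u t v
  continuous : ∀ v, Continuous fun t => u t v

namespace IsUnitaryOneParam

open Filter Topology Complex MeasureTheory

variable {H : Type*} [NormedAddCommGroup H] [InnerProductSpace ℂ H] {u : ℝ → H ≃ₗᵢ[ℝ] H}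

/-- The members of a unitary one-parameter group as complex linear isometries. -/
noncomputable def toLinearIsometry (hu : IsUnitaryOneParam u) (t : ℝ) : H →ₗᵢ[ℂ] H where
  toFun := u t
  map_add' := (u t).map_add
  map_smul' := hu.map_smul t
  norm_map' := (u t).norm_map

@[simp] theorem toLinearIsometry_apply (hu : IsUnitaryOneParam u) (t : ℝ) (v : H) :
    hu.toLinearIsometry t v = u t v := rfl

theorem zero_apply (hu : IsUnitaryOneParam u) (v : H) : u 0 v = v :=
  (u 0).injective (by rw [← hu.map_add, add_zero])

theorem inner_map (hu : IsUnitaryOneParam u) (t : ℝ) (v w : H) :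
    ⟪u t v, u t w⟫_ℂ = ⟪v, w⟫_ℂ := (hu.toLinearIsometry t).inner_map_map v w

theorem inner_left (hu : IsUnitaryOneParam u) (t : ℝ) (v w : H) :
    ⟪u t v, w⟫_ℂ = ⟪v, u (-t) w⟫_ℂ := by
  rw [← hu.inner_map t v, ← hu.map_add, add_neg_cancel, hu.zero_apply]

variable [CompleteSpace H]

theorem integrable_gaussKernel_smul (hu : IsUnitaryOneParam u) (n : ℕ) (z : ℂ) (v : H) :
    Integrable fun s : ℝ => gaussKernel n (s - z) • u s v := by
  refine ((integrable_gaussKernel_sub n z).norm.mul_const ‖v‖).mono'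
    (((continuous_gaussKernel n).comp (by fun_prop)).smul (hu.continuous v)).aestronglyMeasurable
    (ae_of_all _ fun s => by simp [norm_smul])

/-- The regularized operators `∫ g_n(s - z) u(s) ds`. -/
noncomputable def mollify (hu : IsUnitaryOneParam u) (n : ℕ) (z : ℂ) : H →L[ℂ] H :=
  LinearMap.mkContinuous
    { toFun := fun v => ∫ s : ℝ, gaussKernel n (s - z) • u s v
      map_add' := fun v w => by
        rw [← integral_add (hu.integrable_gaussKernel_smul n z v)
          (hu.integrable_gaussKernel_smul n z w)]
        simp
      map_smul' := fun c v => by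
        simp only [hu.map_smul, smul_comm _ c, integral_smul, RingHom.id_apply] }
    (∫ s : ℝ, ‖gaussKernel n (s - z)‖) fun v => by
      rw [← integral_mul_const]
      exact (norm_integral_le_integral_norm _).trans_eq (by simp [norm_smul])

theorem mollify_apply (hu : IsUnitaryOneParam u) (n : ℕ) (z : ℂ) (v : H) :
    hu.mollify n z v = ∫ s : ℝ, gaussKernel n (s - z) • u s v := rfl

/-- An operator that commutes with the one-parameter group commutes with its regularizations. -/
theorem mollify_comm (hu : IsUnitaryOneParam u) (n : ℕ) (z : ℂ) (B : H →L[ℂ] H)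
    (hB : ∀ s v, B (u s v) = u s (B v)) (v : H) : B (hu.mollify n z v) = hu.mollify n z (B v) := by
  rw [mollify_apply, ← B.integral_comp_comm (hu.integrable_gaussKernel_smul n z v)]
  simp [mollify_apply, hB]

theorem mollify_apply_group (hu : IsUnitaryOneParam u) (n : ℕ) (z : ℂ) (t : ℝ) (v : H) :
    u t (hu.mollify n z v) = hu.mollify n z (u t v) := by
  refine hu.mollify_comm n z (hu.toLinearIsometry t).toContinuousLinearMap (fun s w => ?_) v
  simp [← hu.map_add, add_comm]

/-- Translating the integration variable moves a real shift of z onto the vector. Thus `z ↦ mollify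
n z v` extends the orbit map of a regularized vector to an entire function. -/
theorem mollify_add_ofReal (hu : IsUnitaryOneParam u) (n : ℕ) (z : ℂ) (t : ℝ) (v : H) :
    hu.mollify n (z + t) v = hu.mollify n z (u t v) := by
  rw [mollify_apply, mollify_apply, ← integral_add_right_eq_self _ t]
  refine integral_congr_ae (ae_of_all _ fun s => ?_)
  simp only [hu.map_add]
  congr 2
  push_cast
  ring

theorem mollify_ofReal (hu : IsUnitaryOneParam u) (n : ℕ) (t : ℝ) (v : H) :
    hu.mollify n t v = u t (hu.mollify n 0 v) := by
  rw [hu.mollify_apply_group, ← hu.mollify_add_ofReal, zero_add]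

/-- The adjoint of u(s) is u(-s) and the Gaussian is even, so the substitution s ↦ -s turns z into
-z̄. In particular the regularizations at iβ, with β real, are symmetric. -/
theorem inner_mollify_left (hu : IsUnitaryOneParam u) (n : ℕ) (z : ℂ) (v w : H) :
    ⟪hu.mollify n z v, w⟫_ℂ = ⟪v, hu.mollify n (-(starRingEnd ℂ z)) w⟫_ℂ := by
  have h1 : ⟪w, hu.mollify n z v⟫_ℂ = ∫ s : ℝ, ⟪w, gaussKernel n (s - z) • u s v⟫_ℂ :=
    (integral_inner (𝕜 := ℂ) (hu.integrable_gaussKernel_smul n z v) w).symm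
  have h2 : ⟪v, hu.mollify n (-(starRingEnd ℂ z)) w⟫_ℂ =
      ∫ s : ℝ, ⟪v, gaussKernel n (s - (-(starRingEnd ℂ z))) • u s w⟫_ℂ :=
    (integral_inner (𝕜 := ℂ) (hu.integrable_gaussKernel_smul n _ w) v).symm
  rw [← inner_conj_symm, h1, ← integral_conj, h2, ← integral_neg_eq_self]
  refine integral_congr_ae (ae_of_all _ fun s => ?_)
  simp only [inner_smul_right, map_mul, inner_conj_symm, ← gaussKernel_conj, hu.inner_left, neg_neg]
  congr 1
  rw [← gaussKernel_neg]
  congr 1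
  simp
  ring

theorem differentiable_mollify (hu : IsUnitaryOneParam u) (n : ℕ) (v : H) :
    Differentiable ℂ fun z => hu.mollify n z v := by
  intro z₀
  set R := ‖z₀‖ + 1
  set C := Real.sqrt ((n + 1) / Real.pi) * Real.exp ((n + 1) * R ^ 2)
  have hball : ∀ z ∈ Metric.ball z₀ 1, ‖z‖ ≤ R := fun z hz => by
    have := norm_sub_norm_le z z₀
    rw [Metric.mem_ball, dist_eq_norm] at hz
    simp only [R]; linarith
  have hb : (0 : ℝ) < ((n : ℝ) + 1) / 2 := by positivity
  refine (hasDerivAt_integral_of_dominated_loc_of_deriv_le (𝕜 := ℂ) (s := Metric.ball z₀ 1)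
    (F := fun z (s : ℝ) => gaussKernel n (s - z) • u s v)
    (F' := fun z (s : ℝ) => (-(-2 * (n + 1) * (s - z) * gaussKernel n (s - z))) • u s v)
    (bound := fun s : ℝ => 2 * (n + 1) * C * ‖v‖ * (‖s * Real.exp (-((n + 1) / 2) * s ^ 2)‖ +
      R * Real.exp (-((n + 1) / 2) * s ^ 2)))
    (Metric.ball_mem_nhds z₀ one_pos) ?_ (hu.integrable_gaussKernel_smul n z₀ v) ?_ ?_ ?_ ?_).2.differentiableAt
  · exact Eventually.of_forall fun z => (hu.integrable_gaussKernel_smul n z v).aestronglyMeasurable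
  · refine Continuous.aestronglyMeasurable (Continuous.smul ?_ (hu.continuous v))
    have := (continuous_gaussKernel n).comp (f := fun s : ℝ => (s : ℂ) - z₀) (by fun_prop)
    simp only [Function.comp_def] at this
    fun_prop
  · refine ae_of_all _ fun s z hz => ?_
    have h1 := norm_gaussKernel_sub_le n (hball z hz) s
    have h2 : ‖(s : ℂ) - z‖ ≤ |s| + R := by
      refine (norm_sub_le _ _).trans (add_le_add (by simp) (hball z hz))
    have h3 : ‖(n : ℂ) + 1‖ = n + 1 := by
      have : (n : ℂ) + 1 = ((n + 1 : ℝ) : ℂ) := by push_cast; ring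
      rw [this, Complex.norm_real, Real.norm_of_nonneg (by positivity)]
    rw [norm_smul, (u s).norm_map, norm_neg, norm_mul, norm_mul, norm_mul, norm_neg, h3]
    calc ‖(2 : ℂ)‖ * (n + 1) * ‖(s : ℂ) - z‖ * ‖gaussKernel n (s - z)‖ * ‖v‖
        ≤ 2 * (n + 1) * (|s| + R) * (C * Real.exp (-((n + 1) / 2) * s ^ 2)) * ‖v‖ := by
          gcongr; simp
      _ = _ := by
          rw [norm_mul, Real.norm_eq_abs, Real.norm_eq_abs, Real.abs_exp]; ring
  · exact (((integrable_mul_exp_neg_mul_sq hb).norm).add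
      ((integrable_exp_neg_mul_sq hb).const_mul R)).const_mul _
  · refine ae_of_all _ fun s z _ => ?_
    have := ((hasDerivAt_gaussKernel n ((s : ℂ) - z)).comp z ((hasDerivAt_id z).const_sub (s : ℂ)))
    refine (this.smul_const (u s v)).congr_deriv ?_
    simp

/-- The Gaussian regularizations converge strongly to the identity. -/
theorem tendsto_mollify (hu : IsUnitaryOneParam u) (v : H) :
    Tendsto (fun n => hu.mollify n 0 v) atTop (𝓝 v) := by
  -- Rescaling by √(n + 1) fixes the Gaussian and moves n into the group parameter s/√(n + 1), which
  -- tends to 0; one majorant then serves for all n.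
  have hscale : ∀ n : ℕ, hu.mollify n 0 v =
      ∫ s : ℝ, (Real.sqrt (1 / Real.pi) * Real.exp (-1 * s ^ 2) : ℝ) •
        u (s / Real.sqrt (n + 1)) v := by
    intro n
    have hn : (0 : ℝ) < n + 1 := by positivity
    have hr : 0 < Real.sqrt ((n : ℝ) + 1) := Real.sqrt_pos.2 hn
    rw [mollify_apply]
    have := Measure.integral_comp_mul_left (fun s : ℝ => (Real.sqrt (1 / Real.pi) *
      Real.exp (-1 * s ^ 2) : ℝ) • u (s / Real.sqrt (n + 1)) v) (Real.sqrt (n + 1))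
    rw [abs_of_pos (inv_pos.2 hr), eq_comm, inv_smul_eq_iff₀ hr.ne'] at this
    rw [this, ← integral_smul]
    refine integral_congr_ae (ae_of_all _ fun s => ?_)
    simp only [sub_zero]
    rw [mul_div_cancel_left₀ _ hr.ne', smul_smul, ← Complex.coe_smul]
    congr 1
    rw [gaussKernel, mul_pow, Real.sq_sqrt hn.le, ← mul_assoc, ← Real.sqrt_mul hn.le]
    push_cast
    congr 2
    · rw [mul_one_div]
    · ring
  have hint : Integrable fun s : ℝ => Real.sqrt (1 / Real.pi) * Real.exp (-1 * s ^ 2) :=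
    (integrable_exp_neg_mul_sq one_pos).const_mul _
  have hone : ∫ s : ℝ, (Real.sqrt (1 / Real.pi) * Real.exp (-1 * s ^ 2)) • v = v := by
    rw [integral_smul_const, integral_const_mul, integral_gaussian, ← Real.sqrt_mul (by positivity)]
    have : 1 / Real.pi * (Real.pi / 1) = 1 := by field_simp
    rw [this, Real.sqrt_one, one_smul]
  conv => rhs; rw [← hone]
  simp only [hscale]
  refine tendsto_integral_of_dominated_convergence
    (fun s => Real.sqrt (1 / Real.pi) * Real.exp (-1 * s ^ 2) * ‖v‖) (fun n => ?_)
    (hint.mul_const _) (fun n => ae_of_all _ fun s => ?_) (ae_of_all _ fun s => ?_)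
  · have hg : Continuous fun s : ℝ => Real.sqrt (1 / Real.pi) * Real.exp (-1 * s ^ 2) := by
      fun_prop
    exact (hg.smul ((hu.continuous v).comp (by fun_prop))).aestronglyMeasurable
  · rw [norm_smul, (u _).norm_map, Real.norm_of_nonneg (by positivity)]
  · refine Tendsto.const_smul ?_ _
    have h0 : Tendsto (fun n : ℕ => s / Real.sqrt (n + 1)) atTop (𝓝 0) :=
      Tendsto.const_div_atTop (Real.tendsto_sqrt_atTop.comp
        (tendsto_natCast_atTop_atTop.atTop_add tendsto_const_nhds)) s
    have := ((hu.continuous v).tendsto 0).comp h0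
    rwa [hu.zero_apply] at this

end IsUnitaryOneParam

/-! ### The operators `e^{i β A}` -/

section ImaginaryExp

open Filter Topology Complex

variable {H : Type*} [NormedAddCommGroup H] [InnerProductSpace ℂ H] {u : ℝ → H ≃ₗᵢ[ℝ] H}
  {β : ℝ} {v w η ζ : H}

theorem IsStripExtension.unique (hβ : 0 < β) {f : ℝ → H} {F K : ℂ → H}
    (hF : IsStripExtension f β F) (hK : IsStripExtension f β K) {z : ℂ} (hz : 0 ≤ z.im)
    (hz' : z.im ≤ β) : F z = K z :=
  eq_of_strip hβ hF.continuousOn hF.differentiableOn hK.continuousOn hK.differentiableOn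
    (fun t => by rw [hF.eq_ofReal, hK.eq_ofReal]) hz hz'

theorem IsStripExtension.mono {f : ℝ → H} {F : ℂ → H} (hF : IsStripExtension f β F) {β' : ℝ}
    (h : β' ≤ β) : IsStripExtension f β' F where
  continuousOn := hF.continuousOn.mono fun _ hz => ⟨hz.1, hz.2.trans h⟩
  differentiableOn := hF.differentiableOn.mono fun _ hz => ⟨hz.1, hz.2.trans_le h⟩
  eq_ofReal := hF.eq_ofReal

theorem IsStripExtension.sub {f g : ℝ → H} {F K : ℂ → H} (hF : IsStripExtension f β F)
    (hK : IsStripExtension g β K) : IsStripExtension (f - g) β (F - K) where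
  continuousOn := hF.continuousOn.sub hK.continuousOn
  differentiableOn := hF.differentiableOn.sub hK.differentiableOn
  eq_ofReal t := by simp [hF.eq_ofReal, hK.eq_ofReal]

theorem IsStripExtension.add {f g : ℝ → H} {F K : ℂ → H} (hF : IsStripExtension f β F)
    (hK : IsStripExtension g β K) : IsStripExtension (f + g) β (F + K) where
  continuousOn := hF.continuousOn.add hK.continuousOn
  differentiableOn := hF.differentiableOn.add hK.differentiableOn
  eq_ofReal t := by simp [hF.eq_ofReal, hK.eq_ofReal]

theorem IsStripExtension.clm_comp {f : ℝ → H} {F : ℂ → H} (hF : IsStripExtension f β F)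
    {H' : Type*} [NormedAddCommGroup H'] [InnerProductSpace ℂ H'] (B : H →L[ℂ] H') :
    IsStripExtension (fun t => B (f t)) β (fun z => B (F z)) where
  continuousOn := B.continuous.comp_continuousOn hF.continuousOn
  differentiableOn := B.differentiable.comp_differentiableOn hF.differentiableOn
  eq_ofReal t := by simp [hF.eq_ofReal]

/-- Reflection of a strip, combined with an antilinear map. -/
theorem antilinear_comp_strip {X Y : Type*} [NormedAddCommGroup X] [NormedSpace ℂ X]
    [NormedAddCommGroup Y] [NormedSpace ℂ Y] {F : ℂ → X}
    (hc : ContinuousOn F {z : ℂ | 0 ≤ z.im ∧ z.im ≤ β})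
    (hd : DifferentiableOn ℂ F {z : ℂ | 0 < z.im ∧ z.im < β}) (L : X →L⋆[ℂ] Y) :
    ContinuousOn (fun z => L (F (β * I + starRingEnd ℂ z))) {z : ℂ | 0 ≤ z.im ∧ z.im ≤ β} ∧
    DifferentiableOn ℂ (fun z => L (F (β * I + starRingEnd ℂ z)))
      {z : ℂ | 0 < z.im ∧ z.im < β} := by
  constructor
  · refine L.continuous.comp_continuousOn (hc.comp (by fun_prop) fun z hz => ?_)
    simpa [and_comm] using hz
  · intro z hz
    have hopen : IsOpen {z : ℂ | 0 < z.im ∧ z.im < β} :=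
      isOpen_Ioo.preimage Complex.continuous_im
    have h1 : DifferentiableAt ℂ F (β * I + starRingEnd ℂ z) := by
      refine hd.differentiableAt (hopen.mem_nhds ?_)
      simpa [and_comm] using hz
    have h2 : DifferentiableAt ℂ (fun w => F (β * I + w)) (starRingEnd ℂ z) := by
      exact DifferentiableAt.comp (starRingEnd ℂ z) (f := fun w => β * I + w) h1 (by fun_prop)
    exact (h2.antilinear_comp_conj L).differentiableWithinAt

namespace IsUnitaryOneParam

variable (hu : IsUnitaryOneParam u)
include hu

/-- Both sides continue s ↦ u(s + t)v, so uniqueness on the strip identifies them. -/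
theorem stripExtension_add_ofReal (hβ : 0 < β) {F : ℂ → H}
    (hF : IsStripExtension (fun t => u t v) β F) (t : ℝ) {z : ℂ} (hz : 0 ≤ z.im)
    (hz' : z.im ≤ β) : F (z + t) = u t (F z) := by
  refine eq_of_strip hβ (F := fun z => F (z + t))
    (K := fun z => (hu.toLinearIsometry t).toContinuousLinearMap (F z)) ?_ ?_
    (hF.clm_comp _).continuousOn (hF.clm_comp _).differentiableOn (fun s => ?_) hz hz'
  · exact hF.continuousOn.comp (by fun_prop) fun z hz => by simpa using hz
  · exact hF.differentiableOn.comp (by fun_prop) fun z hz => by simpa using hz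
  · have := hF.eq_ofReal (s + t)
    push_cast at this
    rw [this, add_comm, hu.map_add, ← hF.eq_ofReal s]
    rfl

theorem imaginaryExpGraph_right_unique (hβ : 0 < β) (h : (v, η) ∈ imaginaryExpGraph u β)
    (h' : (v, ζ) ∈ imaginaryExpGraph u β) : η = ζ := by
  obtain ⟨F, hF, rfl⟩ := h
  obtain ⟨K, hK, rfl⟩ := h'
  exact hF.unique hβ hK (by simpa using hβ.le) (by simp)

theorem imaginaryExpGraph_add (h : (v, η) ∈ imaginaryExpGraph u β)
    (h' : (w, ζ) ∈ imaginaryExpGraph u β) : (v + w, η + ζ) ∈ imaginaryExpGraph u β := by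
  obtain ⟨F, hF, rfl⟩ := h
  obtain ⟨K, hK, rfl⟩ := h'
  refine ⟨F + K, ⟨(hF.add hK).1, (hF.add hK).2, fun t => ?_⟩, rfl⟩
  simp [hF.eq_ofReal, hK.eq_ofReal]

theorem imaginaryExpGraph_smul (c : ℂ) (h : (v, η) ∈ imaginaryExpGraph u β) :
    (c • v, c • η) ∈ imaginaryExpGraph u β := by
  obtain ⟨F, hF, rfl⟩ := h
  refine ⟨c • F, ⟨hF.1.const_smul c, hF.2.const_smul c, fun t => ?_⟩, rfl⟩
  simp [hF.eq_ofReal, hu.map_smul]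

theorem imaginaryExpGraph_sub (h : (v, η) ∈ imaginaryExpGraph u β)
    (h' : (w, ζ) ∈ imaginaryExpGraph u β) : (v - w, η - ζ) ∈ imaginaryExpGraph u β := by
  have := hu.imaginaryExpGraph_add h (hu.imaginaryExpGraph_smul (-1) h')
  simpa [sub_eq_add_neg] using this

/-- The three lines bound for orbit maps. -/
theorem norm_stripExtension_le (hβ : 0 < β) {F : ℂ → H}
    (hF : IsStripExtension (fun t => u t v) β F) {z : ℂ} (hz : 0 ≤ z.im) (hz' : z.im ≤ β) :
    ‖F z‖ ≤ max ‖v‖ ‖F (β * I)‖ := by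
  -- Covariance under real shifts makes ‖F z‖ depend on Im z only. Hence F is bounded on the strip
  -- by compactness of [0, β], which gives the growth condition of Phragmén–Lindelöf.
  have hshift : ∀ z : ℂ, 0 ≤ z.im → z.im ≤ β → ‖F z‖ = ‖F (z.im * I)‖ := by
    intro z hz hz'
    have := hu.stripExtension_add_ofReal hβ hF z.re (z := z.im * I) (by simpa) (by simpa)
    rw [add_comm, Complex.re_add_im] at this
    rw [this, (u _).norm_map]
  have h0 : F 0 = v := by simpa [hu.zero_apply] using hF.eq_ofReal 0
  obtain ⟨C, hC⟩ : ∃ C, ∀ y ∈ Icc 0 β, ‖F ((y : ℝ) * I)‖ ≤ C := by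
    refine isCompact_Icc.exists_bound_of_continuousOn (f := fun y : ℝ => F (y * I)) ?_
    exact hF.continuousOn.comp (by fun_prop) fun y hy => by simpa using hy
  have hcl : closure (im ⁻¹' Ioo 0 β) ⊆ {z : ℂ | 0 ≤ z.im ∧ z.im ≤ β} :=
    closure_minimal (fun z hz => ⟨hz.1.le, hz.2.le⟩) (isClosed_Icc.preimage Complex.continuous_im)
  refine PhragmenLindelof.horizontal_strip (a := 0) (b := β)
    ⟨hF.differentiableOn, hF.continuousOn.mono hcl⟩
    ⟨0, by positivity, 0, ?_⟩ (fun z hz => ?_) (fun z hz => ?_) hz hz'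
  · refine Asymptotics.IsBigO.of_bound C ?_
    refine eventually_inf_principal.2 (Eventually.of_forall fun z hz => ?_)
    rw [hshift z hz.1.le hz.2.le]
    simpa using hC z.im ⟨hz.1.le, hz.2.le⟩
  · rw [hshift z hz.ge (hz.le.trans hβ.le), hz]
    simp [h0]
  · rw [hshift z (hβ.le.trans hz.ge) hz.le, hz]
    simp

/-- The operator `e^{i β A}` is closed. -/
theorem mem_imaginaryExpGraph_of_tendsto [CompleteSpace H] (hβ : 0 < β) {a b : ℕ → H}
    (h : ∀ n, (a n, b n) ∈ imaginaryExpGraph u β) (ha : Tendsto a atTop (𝓝 v))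
    (hb : Tendsto b atTop (𝓝 η)) : (v, η) ∈ imaginaryExpGraph u β := by
  choose F hF hFb using h
  set S := {z : ℂ | 0 ≤ z.im ∧ z.im ≤ β}
  -- The three lines bound turns convergence at the two ends, 0 and iβ, into uniform convergence on
  -- the strip.
  have hbound : ∀ m n, ∀ z ∈ S, ‖F m z - F n z‖ ≤ max ‖a m - a n‖ ‖b m - b n‖ := by
    intro m n z hz
    have h1 := (hF m).sub (hF n)
    have h2 : IsStripExtension (fun t => u t (a m - a n)) β (F m - F n) :=
      ⟨h1.1, h1.2, fun t => by rw [h1.3]; simp⟩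
    have := hu.norm_stripExtension_le hβ h2 hz.1 hz.2
    simpa [hFb] using this
  have hcauchy : UniformCauchySeqOn F atTop S := by
    rw [Metric.uniformCauchySeqOn_iff]
    intro ε hε
    obtain ⟨N₁, h1⟩ := Metric.cauchySeq_iff.1 ha.cauchySeq ε hε
    obtain ⟨N₂, h2⟩ := Metric.cauchySeq_iff.1 hb.cauchySeq ε hε
    refine ⟨max N₁ N₂, fun m hm n hn z hz => ?_⟩
    rw [dist_eq_norm]
    refine (hbound m n z hz).trans_lt (max_lt ?_ ?_)
    · simpa [dist_eq_norm] using h1 m (le_of_max_le_left hm) n (le_of_max_le_left hn)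
    · simpa [dist_eq_norm] using h2 m (le_of_max_le_right hm) n (le_of_max_le_right hn)
  have hpt : ∀ z, ∃ L, z ∈ S → Tendsto (fun n => F n z) atTop (𝓝 L) := by
    intro z
    by_cases hz : z ∈ S
    · obtain ⟨L, hL⟩ := cauchySeq_tendsto_of_complete (hcauchy.cauchySeq hz)
      exact ⟨L, fun _ => hL⟩
    · exact ⟨0, fun h => absurd h hz⟩
  choose K hK using hpt
  have hunif : TendstoUniformlyOn F K atTop S :=
    hcauchy.tendstoUniformlyOn_of_tendsto fun z hz => hK z hz
  have hopen : IsOpen {z : ℂ | 0 < z.im ∧ z.im < β} := isOpen_Ioo.preimage Complex.continuous_im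
  refine ⟨K, ⟨hunif.continuousOn (Frequently.of_forall fun n => (hF n).continuousOn), ?_,
    fun t => ?_⟩, ?_⟩
  · refine (hunif.mono fun z hz => ⟨hz.1.le, hz.2.le⟩).tendstoLocallyUniformlyOn.differentiableOn
      (Eventually.of_forall fun n => (hF n).differentiableOn) hopen
  · refine tendsto_nhds_unique (hK t (by simpa [S] using hβ.le)) ?_
    simp only [(hF _).eq_ofReal]
    exact ((u t).continuous.tendsto v).comp ha
  · refine tendsto_nhds_unique (hK (β * I) (by simpa [S] using hβ.le)) ?_
    simpa only [hFb] using hb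

/-- Symmetry of e^{iβA}: the function ⟪F(iβ + z̄), K(z)⟫ is holomorphic, and constant on ℝ by
unitarity, hence constant. Its values at 0 and iβ are the two sides. -/
theorem inner_imaginaryExpGraph (hβ : 0 < β) (h : (v, η) ∈ imaginaryExpGraph u β)
    (h' : (w, ζ) ∈ imaginaryExpGraph u β) : ⟪η, w⟫_ℂ = ⟪v, ζ⟫_ℂ := by
  obtain ⟨F, hF, rfl⟩ := h
  obtain ⟨K, hK, rfl⟩ := h'
  have h1 := antilinear_comp_strip hF.continuousOn hF.differentiableOn (innerSL ℂ)
  have hmid := fun t => hu.stripExtension_add_ofReal hβ hF t (z := β * I) (by simpa using hβ.le)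
    (by simp)
  have hF0 : F 0 = v := by simpa [hu.zero_apply] using hF.eq_ofReal 0
  have hconst : ∀ z : ℂ, 0 ≤ z.im → z.im ≤ β →
      (innerSL ℂ (F (β * I + starRingEnd ℂ z))) (K z) = ⟪F (β * I), w⟫_ℂ := fun z hz hz' =>
    eq_of_strip hβ (K := fun _ => ⟪F (β * I), w⟫_ℂ)
      (h1.1.clm_apply hK.continuousOn)
      (h1.2.clm_apply hK.differentiableOn) continuousOn_const
      (differentiableOn_const _) (fun t => by simp [hmid, hK.eq_ofReal, hu.inner_map]) hz hz'
  have := hconst (β * I) (by simpa using hβ.le) (by simp)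
  rw [← this]
  simp [hF0]

variable [CompleteSpace H]

/-- Both sides have the same values on ℝ. So, after regularization, any strip extension is read off
from an entire function of the initial vector. -/
theorem mollify_stripExtension (hβ : 0 < β) {F : ℂ → H}
    (hF : IsStripExtension (fun t => u t v) β F) (n : ℕ) (x : ℂ) {z : ℂ} (hz : 0 ≤ z.im)
    (hz' : z.im ≤ β) : hu.mollify n x (F z) = hu.mollify n (x + z) v := by
  have hd : Differentiable ℂ fun z => hu.mollify n (x + z) v :=
    (hu.differentiable_mollify n v).comp (by fun_prop)
  exact eq_of_strip hβ (K := fun z => hu.mollify n (x + z) v)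
    (hF.clm_comp (hu.mollify n x)).continuousOn
    (hF.clm_comp (hu.mollify n x)).differentiableOn hd.continuous.continuousOn hd.differentiableOn
    (fun t => by rw [hF.eq_ofReal, hu.mollify_add_ofReal]) hz hz'

/-- Regularized vectors are entire. -/
theorem mollify_mem_imaginaryExpGraph (n : ℕ) (x : ℂ) (v : H) :
    (hu.mollify n x v, hu.mollify n (x + β * I) v) ∈ imaginaryExpGraph u β := by
  have hd : Differentiable ℂ fun z => hu.mollify n (x + z) v :=
    (hu.differentiable_mollify n v).comp (by fun_prop)
  exact ⟨fun z => hu.mollify n (x + z) v, ⟨hd.continuous.continuousOn, hd.differentiableOn,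
    fun t => by rw [hu.mollify_add_ofReal, ← hu.mollify_apply_group]⟩, rfl⟩

/-- The graph of `e^{i β A}` in terms of Gaussian regularizations. -/
theorem mem_imaginaryExpGraph_iff (hβ : 0 < β) :
    (v, η) ∈ imaginaryExpGraph u β ↔
      ∀ n, hu.mollify n (β * I) v = hu.mollify n 0 η := by
  constructor
  · rintro ⟨F, hF, rfl⟩ n
    rw [hu.mollify_stripExtension hβ hF n 0 (by simpa using hβ.le) (by simp), zero_add]
  · intro h
    -- The regularized pairs belong to the graph and converge to (v, η); closedness of the graph
    -- concludes.
    refine hu.mem_imaginaryExpGraph_of_tendsto hβ (fun n => ?_) (hu.tendsto_mollify v)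
      (hu.tendsto_mollify η)
    rw [← h n]
    simpa using hu.mollify_mem_imaginaryExpGraph (β := β) n 0 v

theorem mollify_eq_of_mem (hβ : 0 < β) (h : (v, η) ∈ imaginaryExpGraph u β) (n : ℕ) (x : ℂ) :
    hu.mollify n x η = hu.mollify n (x + β * I) v := by
  obtain ⟨F, hF, rfl⟩ := h
  exact hu.mollify_stripExtension hβ hF n x (by simpa using hβ.le) (by simp)

theorem imaginaryExpGraph_comp (hβ : 0 < β) {γ : ℝ} (hγ : 0 < γ)
    (h : (v, η) ∈ imaginaryExpGraph u β) (h' : (η, ζ) ∈ imaginaryExpGraph u γ) :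
    (v, ζ) ∈ imaginaryExpGraph u (β + γ) := by
  rw [hu.mem_imaginaryExpGraph_iff (add_pos hβ hγ)]
  intro n
  have := hu.mollify_eq_of_mem hγ h' n 0
  rw [this, hu.mollify_eq_of_mem hβ h]
  congr 2
  push_cast
  ring

-- The intermediate vector is F(iβ): the extension up to height β + γ, shifted by iβ, continues its
-- orbit. With β = γ = π this splits e^{2πiA} into two factors e^{πiA}.
omit [CompleteSpace H] in
theorem exists_imaginaryExpGraph_of_add (hβ : 0 < β) {γ : ℝ} (hγ : 0 < γ)
    (h : (v, ζ) ∈ imaginaryExpGraph u (β + γ)) :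
    ∃ η, (v, η) ∈ imaginaryExpGraph u β ∧ (η, ζ) ∈ imaginaryExpGraph u γ := by
  obtain ⟨F, hF, rfl⟩ := h
  refine ⟨F (β * I), ⟨F, hF.mono (by linarith), rfl⟩, fun z => F (z + β * I), ⟨?_, ?_, fun t => ?_⟩,
    ?_⟩
  · refine hF.continuousOn.comp (by fun_prop) fun z hz => ?_
    simp at hz ⊢
    constructor <;> linarith
  · refine hF.differentiableOn.comp (by fun_prop) fun z hz => ?_
    simp at hz ⊢
    constructor <;> linarith
  · rw [add_comm]
    exact hu.stripExtension_add_ofReal (add_pos hβ hγ) hF t (by simpa using hβ.le)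
      (by simpa using hγ.le)
  · change F (γ * I + β * I) = F ((β + γ : ℝ) * I)
    congr 1; push_cast; ring

/-- The operator `e^{i β A}` contains its adjoint. -/
theorem mem_imaginaryExpGraph_of_forall_inner (hβ : 0 < β)
    (h : ∀ q r, (q, r) ∈ imaginaryExpGraph u β → ⟪ζ, q⟫_ℂ = ⟪η, r⟫_ℂ) :
    (η, ζ) ∈ imaginaryExpGraph u β := by
  rw [hu.mem_imaginaryExpGraph_iff hβ]
  intro n
  refine ext_inner_right ℂ fun q => ?_
  -- Regularized vectors are admissible test vectors, and -conj(iβ) = iβ, so the same regularization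
  -- appears after taking adjoints.
  rw [hu.inner_mollify_left, hu.inner_mollify_left]
  have := h _ _ (hu.mollify_mem_imaginaryExpGraph n 0 q)
  simp only [zero_add] at this
  simp [this]

/-- Let `W` be a second one-parameter group with `u(t) W(s) = W(s e^{kt}) u(t)` for an integer `k`.
On its natural domain, `e^{i π A}` intertwines `W(s)` with `W((-1)^k s)`. -/
theorem imaginaryExpGraph_intertwine {W : ℝ → H ≃ₗᵢ[ℝ] H} (hW : IsUnitaryOneParam W) (k : ℤ)
    (huW : ∀ t s v, u t (W s v) = W (s * Real.exp (k * t)) (u t v)) {s : ℝ}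
    (h : (v, η) ∈ imaginaryExpGraph u Real.pi) (h' : (W s v, ζ) ∈ imaginaryExpGraph u Real.pi) :
    ζ = W ((-1) ^ k * s) η := by
  obtain ⟨F, hF, rfl⟩ := h
  obtain ⟨K, hK, rfl⟩ := h'
  have hπ := Real.pi_pos
  -- This continues the group parameter s e^{kt} to complex t; at πi it equals (-1)^k s.
  set e : ℂ → ℂ := fun z => s * cexp (k * z)
  have he : Differentiable ℂ e := by simp only [e]; fun_prop
  -- W cannot be evaluated at complex parameters, but its regularizations can; the regularization is
  -- removed at the end by letting n tend to infinity.
  have hkey : ∀ n, hW.mollify n 0 (K (Real.pi * I)) =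
      hW.mollify n 0 (W ((-1) ^ k * s) (F (Real.pi * I))) := by
    intro n
    refine ext_inner_left ℂ fun x => ?_
    -- The regularized W is moved to the antilinear slot of the inner product. Conjugating the
    -- parameter as well makes the resulting functional holomorphic in z.
    have hB : Differentiable ℂ
        (fun z => innerSL ℂ (hW.mollify n (-(starRingEnd ℂ (e z))) x)) := by
      intro z
      have h1 : DifferentiableAt ℂ
          (fun w => hW.mollify n (-(s * cexp (k * w))) x) (starRingEnd ℂ z) :=
        ((hW.differentiable_mollify n x).comp (by fun_prop)).differentiableAt
      have h2 := h1.antilinear_comp_conj (innerSL ℂ)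
      refine h2.congr_of_eventuallyEq (Eventually.of_forall fun w => ?_)
      simp [e, ← Complex.exp_conj]
    have h3 : ∀ z : ℂ, 0 ≤ z.im → z.im ≤ Real.pi → ⟪x, hW.mollify n 0 (K z)⟫_ℂ =
        (innerSL ℂ (hW.mollify n (-(starRingEnd ℂ (e z))) x)) (F z) := fun z hz hz' =>
      eq_of_strip hπ (F := fun z => ⟪x, hW.mollify n 0 (K z)⟫_ℂ)
        (K := fun z => (innerSL ℂ (hW.mollify n (-(starRingEnd ℂ (e z))) x)) (F z))
        ((hK.clm_comp ((innerSL ℂ x).comp (hW.mollify n 0))).continuousOn)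
        ((hK.clm_comp ((innerSL ℂ x).comp (hW.mollify n 0))).differentiableOn)
        (hB.continuous.continuousOn.clm_apply hF.continuousOn)
        (hB.differentiableOn.clm_apply hF.differentiableOn) (fun t => by
          have h4 : e t = ((s * Real.exp (k * t) : ℝ) : ℂ) := by simp [e]
          rw [hK.eq_ofReal, huW, innerSL_apply_apply, hW.inner_mollify_left, map_neg,
            starRingEnd_self_apply, neg_neg, h4, hF.eq_ofReal, hW.mollify_ofReal,
            hW.mollify_apply_group]) hz hz'
    have h5 := h3 (Real.pi * I) (by simpa using hπ.le) (by simp)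
    have h6 : e (Real.pi * I) = (((-1) ^ k * s : ℝ) : ℂ) := by
      simp only [e]
      rw [Complex.exp_int_mul, Complex.exp_pi_mul_I]
      push_cast
      ring
    rw [h5, innerSL_apply_apply, hW.inner_mollify_left, map_neg, starRingEnd_self_apply, neg_neg,
      h6, hW.mollify_ofReal, hW.mollify_apply_group]
  exact tendsto_nhds_unique (hW.tendsto_mollify _)
    ((hW.tendsto_mollify _).congr fun n => (hkey n).symm)

end IsUnitaryOneParam

end ImaginaryExp

/-! ### Modular operators of standard subspaces -/

section ModularTheory

open Filter Topology Complex

variable {H : Type*} [NormedAddCommGroup H] [InnerProductSpace ℂ H] {u : ℝ → H ≃ₗᵢ[ℝ] H}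
  {J : H ≃ₗᵢ[ℝ] H} {v w ξ η ζ : H} {V : Submodule ℝ H}

theorem inner_antiunitary (hJ : ∀ (c : ℂ) v, J (c • v) = starRingEnd ℂ c • J v) (v w : H) :
    ⟪J v, J w⟫_ℂ = ⟪w, v⟫_ℂ := by
  have h1 : I • J w = -J (I • w) := by rw [hJ]; simp
  rw [← inner_conj_symm w v, inner_eq_sum_norm_sq_div_four, inner_eq_sum_norm_sq_div_four v w]
  simp only [RCLike.I_to_complex]
  rw [h1, sub_neg_eq_add, ← sub_eq_add_neg, ← map_add, ← map_sub, ← map_add, ← map_sub]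
  simp only [LinearIsometryEquiv.norm_map]
  have h4 : starRingEnd ℂ (4 : ℂ) = 4 := Complex.conj_ofReal 4
  simp [h4]
  ring

/-- An antilinear isometry as a continuous antilinear map. -/
noncomputable def antilinearCLM (J : H ≃ₗᵢ[ℝ] H)
    (hJ : ∀ (c : ℂ) v, J (c • v) = starRingEnd ℂ c • J v) : H →L⋆[ℂ] H where
  toFun := J
  map_add' := J.map_add
  map_smul' := hJ
  cont := J.continuous

/-- Since J is antilinear and commutes with u, J F(iβ + z̄) continues the orbit of Jη and ends at
Jξ: conjugation by J inverts e^{iβA}. -/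
theorem IsUnitaryOneParam.imaginaryExpGraph_antiunitary (hu : IsUnitaryOneParam u)
    (hJ : ∀ (c : ℂ) v, J (c • v) = starRingEnd ℂ c • J v)
    (hJu : ∀ t v, J (u t v) = u t (J v)) {β : ℝ} (hβ : 0 < β)
    (h : (ξ, η) ∈ imaginaryExpGraph u β) : (J η, J ξ) ∈ imaginaryExpGraph u β := by
  obtain ⟨F, hF, rfl⟩ := h
  have h1 := antilinear_comp_strip hF.continuousOn hF.differentiableOn (antilinearCLM J hJ)
  refine ⟨_, ⟨h1.1, h1.2, fun t => ?_⟩, ?_⟩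
  · change J (F (β * I + starRingEnd ℂ (t : ℂ))) = u t (J (F (β * I)))
    rw [Complex.conj_ofReal, hu.stripExtension_add_ofReal hβ hF t (by simpa using hβ.le) (by simp),
      hJu]
  · change J (F (β * I + starRingEnd ℂ (β * I))) = J ξ
    have := hF.eq_ofReal 0
    simp only [ofReal_zero, hu.zero_apply] at this
    simp [this]

/-- Structure of the fixed space `Fix (J e^{i π A})`. -/
structure IsFixedSpace (u : ℝ → H ≃ₗᵢ[ℝ] H) (J : H ≃ₗᵢ[ℝ] H) (V : Submodule ℝ H) : Prop where
  isUnitaryOneParam : IsUnitaryOneParam u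
  conj_smul : ∀ (c : ℂ) v, J (c • v) = starRingEnd ℂ c • J v
  conj_conj : ∀ v, J (J v) = v
  conj_comm : ∀ t v, J (u t v) = u t (J v)
  mem_iff : ∀ v, v ∈ V ↔ (v, J v) ∈ imaginaryExpGraph u Real.pi

namespace IsFixedSpace

variable (hV : IsFixedSpace u J V)
include hV

/-- This identifies the Tomita operator with S = J e^{πiA}, domains included. On its domain S is an
antilinear involution, so ξ splits as a + ib with a = (ξ + Sξ)/2 and b = (ξ - Sξ)/(2i), both fixed
by S. -/
theorem mem_tomitaGraph_iff : (ξ, η) ∈ tomitaGraph V ↔ (ξ, J η) ∈ imaginaryExpGraph u Real.pi := by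
  have hu := hV.isUnitaryOneParam
  constructor
  · rintro ⟨a, ha, b, hb, rfl, rfl⟩
    rw [map_sub, hV.conj_smul, conj_I, neg_smul, sub_neg_eq_add]
    exact hu.imaginaryExpGraph_add ((hV.mem_iff a).1 ha)
      (hu.imaginaryExpGraph_smul I ((hV.mem_iff b).1 hb))
  · intro h
    have h' := hu.imaginaryExpGraph_antiunitary hV.conj_smul hV.conj_comm Real.pi_pos h
    rw [hV.conj_conj] at h'
    have h1 : starRingEnd ℂ (2 : ℂ) = 2 := Complex.conj_ofReal 2
    have h2 : starRingEnd ℂ (2⁻¹ : ℂ) = 2⁻¹ := by rw [map_inv₀, h1]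
    refine ⟨(2⁻¹ : ℂ) • (ξ + η), ?_, (2⁻¹ * -I : ℂ) • (ξ - η), ?_, ?_, ?_⟩
    · rw [hV.mem_iff, hV.conj_smul, map_add, h2, add_comm (J ξ)]
      exact hu.imaginaryExpGraph_smul _ (hu.imaginaryExpGraph_add h h')
    · have h3 : J ((2⁻¹ * -I : ℂ) • (ξ - η)) = (2⁻¹ * -I : ℂ) • (J η - J ξ) := by
        rw [hV.conj_smul, map_sub, ← neg_sub (J η), smul_neg, ← neg_smul]
        congr 1
        simp [h1]
      rw [hV.mem_iff, h3]
      exact hu.imaginaryExpGraph_smul _ (hu.imaginaryExpGraph_sub h h')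
    · rw [smul_smul, show (I * (2⁻¹ * -I) : ℂ) = 2⁻¹ by linear_combination (-2⁻¹ : ℂ) * I_mul_I]
      module
    · rw [smul_smul, show (I * (2⁻¹ * -I) : ℂ) = 2⁻¹ by linear_combination (-2⁻¹ : ℂ) * I_mul_I]
      module

theorem isSeparatingSubspace : IsSeparatingSubspace V := by
  have hu := hV.isUnitaryOneParam
  rintro v hv w hw rfl
  have h1 := (hV.mem_iff _).1 hv
  have h2 := hu.imaginaryExpGraph_smul I ((hV.mem_iff _).1 hw)
  have h3 := hu.imaginaryExpGraph_right_unique Real.pi_pos h1 h2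
  rw [hV.conj_smul, conj_I, neg_smul, neg_eq_iff_add_eq_zero, ← two_smul ℂ, smul_smul,
    smul_eq_zero] at h3
  rcases h3 with h3 | h3
  · simp at h3
  · rw [← map_zero J, J.injective.eq_iff] at h3
    simp [h3]

variable [CompleteSpace H]

theorem isClosed : IsClosed (V : Set H) := by
  refine isSeqClosed_iff_isClosed.1 fun x v hx hv => ?_
  exact (hV.mem_iff v).2 (hV.isUnitaryOneParam.mem_imaginaryExpGraph_of_tendsto Real.pi_pos
    (fun n => (hV.mem_iff _).1 (hx n)) hv ((J.continuous.tendsto v).comp hv))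

/-- The modular operator of `Fix (J e^{i π A})` is `e^{2 π i A}`. -/
theorem modularOperatorGraph_eq :
    modularOperatorGraph V = imaginaryExpGraph u (2 * Real.pi) := by
  have hu := hV.isUnitaryOneParam
  ext ⟨ξ, ζ⟩
  -- The adjoint of T = J e^{πiA} is e^{πiA} J, so T*T = e^{πiA} J J e^{πiA} = e^{2πiA}.
  have hadj : ∀ η, (η, ζ) ∈ antilinearAdjointGraph (tomitaGraph V) ↔
      (J η, ζ) ∈ imaginaryExpGraph u Real.pi := by
    intro η
    constructor
    · refine fun h => hu.mem_imaginaryExpGraph_of_forall_inner Real.pi_pos fun q r hqr => ?_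
      have := h (q, J r) (hV.mem_tomitaGraph_iff.2 (by rwa [hV.conj_conj]))
      rw [this]
      change ⟪J r, η⟫_ℂ = _
      rw [← inner_antiunitary hV.conj_smul, hV.conj_conj]
    · rintro h ⟨q, r⟩ hqr
      have := hu.inner_imaginaryExpGraph Real.pi_pos h (hV.mem_tomitaGraph_iff.1 hqr)
      change ⟪ζ, q⟫_ℂ = ⟪r, η⟫_ℂ
      rw [this, inner_antiunitary hV.conj_smul]
  constructor
  · rintro ⟨η, h1, h2⟩
    rw [two_mul]
    exact hu.imaginaryExpGraph_comp Real.pi_pos Real.pi_pos (hV.mem_tomitaGraph_iff.1 h1)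
      ((hadj η).1 h2)
  · intro h
    rw [two_mul] at h
    obtain ⟨η, h1, h2⟩ := hu.exists_imaginaryExpGraph_of_add Real.pi_pos Real.pi_pos h
    refine ⟨J η, hV.mem_tomitaGraph_iff.2 (by rwa [hV.conj_conj]), (hadj _).2 ?_⟩
    rwa [hV.conj_conj]

end IsFixedSpace

/-! ### The Tomita operator of a general closed real subspace. -/

theorem tomitaGraph_add {p q : H × H} (hp : p ∈ tomitaGraph V) (hq : q ∈ tomitaGraph V) :
    p + q ∈ tomitaGraph V := by
  obtain ⟨a, ha, b, hb, h1, h2⟩ := hp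
  obtain ⟨c, hc, d, hd, h3, h4⟩ := hq
  refine ⟨a + c, V.add_mem ha hc, b + d, V.add_mem hb hd, ?_, ?_⟩
  · rw [Prod.fst_add, h1, h3]; module
  · rw [Prod.snd_add, h2, h4]; module

theorem tomitaGraph_smul (r : ℝ) {p : H × H} (hp : p ∈ tomitaGraph V) :
    r • p ∈ tomitaGraph V := by
  obtain ⟨a, ha, b, hb, h1, h2⟩ := hp
  refine ⟨r • a, V.smul_mem r ha, r • b, V.smul_mem r hb, ?_, ?_⟩
  · rw [Prod.smul_fst, h1, smul_add, smul_comm]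
  · rw [Prod.smul_snd, h2, smul_sub, smul_comm]

theorem tomitaGraph_I_smul (h : (ξ, η) ∈ tomitaGraph V) : (I • ξ, -(I • η)) ∈ tomitaGraph V := by
  obtain ⟨a, ha, b, hb, h1, h2⟩ := h
  refine ⟨-b, V.neg_mem hb, a, ha, ?_, ?_⟩
  · change I • ξ = _
    rw [show ξ = _ from h1, smul_add, smul_smul, I_mul_I]; module
  · change -(I • η) = _
    rw [show η = _ from h2, smul_sub, smul_smul, I_mul_I]; module

theorem mem_tomitaGraph_iff : (ξ, η) ∈ tomitaGraph V ↔
    (2⁻¹ : ℂ) • (ξ + η) ∈ V ∧ (2⁻¹ * -I : ℂ) • (ξ - η) ∈ V := by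
  have hI : (I * (2⁻¹ * -I) : ℂ) = 2⁻¹ := by linear_combination (-2⁻¹ : ℂ) * I_mul_I
  constructor
  · rintro ⟨a, ha, b, hb, h1, h2⟩
    simp only at h1 h2
    subst h1 h2
    constructor
    · convert ha using 1; module
    · convert hb using 1
      rw [show a + I • b - (a - I • b) = (2 * I : ℂ) • b by module, smul_smul,
        show (2⁻¹ * -I * (2 * I) : ℂ) = 1 by linear_combination (-1 : ℂ) * I_mul_I, one_smul]
  · rintro ⟨h1, h2⟩
    refine ⟨_, h1, _, h2, ?_, ?_⟩ <;> simp only [smul_smul, hI] <;> module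

theorem isClosed_tomitaGraph (hV : IsClosed (V : Set H)) : IsClosed (tomitaGraph V) := by
  have h1 : Continuous fun p : H × H => (2⁻¹ : ℂ) • (p.1 + p.2) := by fun_prop
  have h2 : Continuous fun p : H × H => (2⁻¹ * -I : ℂ) • (p.1 - p.2) := by fun_prop
  convert (hV.preimage h1).inter (hV.preimage h2) using 1
  ext ⟨ξ, η⟩
  exact mem_tomitaGraph_iff

theorem antilinearAdjointGraph_sub {T : Set (H × H)} {p q : H × H}
    (hp : p ∈ antilinearAdjointGraph T) (hq : q ∈ antilinearAdjointGraph T) :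
    p - q ∈ antilinearAdjointGraph T := fun r hr => by
  rw [Prod.snd_sub, Prod.fst_sub, inner_sub_left, inner_sub_right, hp r hr, hq r hr]

theorem antilinearAdjointGraph_smul {T : Set (H × H)} (r : ℝ) {p : H × H}
    (hp : p ∈ antilinearAdjointGraph T) : r • p ∈ antilinearAdjointGraph T := fun q hq => by
  rw [Prod.smul_snd, Prod.smul_fst, ← Complex.coe_smul, ← Complex.coe_smul, inner_smul_left,
    inner_smul_right, hp q hq, conj_ofReal]

/-- The Tomita operator as a real subspace of the Hilbert space `H ⊕ H`. -/
def tomitaSubmodule (V : Submodule ℝ H) : Submodule ℝ (WithLp 2 (H × H)) where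
  carrier := {p | (p.fst, p.snd) ∈ tomitaGraph V}
  zero_mem' := ⟨0, V.zero_mem, 0, V.zero_mem, by simp, by simp⟩
  add_mem' := tomitaGraph_add
  smul_mem' r _ := tomitaGraph_smul r

/-- The restriction of the Tomita operator to the domain of the modular operator. -/
def tomitaCore (V : Submodule ℝ H) : Submodule ℝ (WithLp 2 (H × H)) where
  carrier := {p | (p.fst, p.snd) ∈ tomitaGraph V ∧
    ∃ ζ, (p.snd, ζ) ∈ antilinearAdjointGraph (tomitaGraph V)}
  zero_mem' := ⟨(tomitaSubmodule V).zero_mem, 0, fun _ _ => by simp⟩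
  add_mem' := by
    rintro p q ⟨hp, ζ, hζ⟩ ⟨hq, ζ', hζ'⟩
    refine ⟨tomitaGraph_add hp hq, ζ + ζ', ?_⟩
    simpa using antilinearAdjointGraph_sub hζ (antilinearAdjointGraph_smul (-1) hζ')
  smul_mem' := by
    rintro r p ⟨hp, ζ, hζ⟩
    exact ⟨tomitaGraph_smul r hp, r • ζ, antilinearAdjointGraph_smul r hζ⟩

variable [CompleteSpace H]

theorem isClosed_tomitaSubmodule (hV : IsClosed (V : Set H)) :
    IsClosed (tomitaSubmodule V : Set (WithLp 2 (H × H))) :=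
  (isClosed_tomitaGraph hV).preimage (WithLp.prod_continuous_ofLp 2 H H)

/-- `1 + T* T` is surjective. -/
theorem exists_add_modularOperator_eq (hV : IsClosed (V : Set H)) (ζ : H) :
    ∃ ξ η, (ξ, η) ∈ tomitaGraph V ∧ (η, ζ - ξ) ∈ antilinearAdjointGraph (tomitaGraph V) := by
  let _ : InnerProductSpace ℝ H := InnerProductSpace.complexToReal
  have : CompleteSpace (tomitaSubmodule V) := (isClosed_tomitaSubmodule hV).completeSpace_coe
  -- Von Neumann's argument: split (ζ, 0) into its projection (ξ, Tξ) on the closed graph and an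
  -- orthogonal remainder (ζ - ξ, -Tξ).
  obtain ⟨q, hq, r, hr, hqr⟩ :=
    Submodule.exists_add_mem_mem_orthogonal (𝕜 := ℝ) (K := tomitaSubmodule V)
      (WithLp.toLp 2 (ζ, (0 : H)))
  have h1 : r.fst = ζ - q.fst := by
    have := congrArg (fun p : WithLp 2 (H × H) => p.fst) hqr
    simp at this
    simp [this]
  have h2 : r.snd = -q.snd := by
    have := congrArg (fun p : WithLp 2 (H × H) => p.snd) hqr
    simp at this
    exact (neg_eq_of_add_eq_zero_right this.symm).symm
  refine ⟨q.fst, q.snd, hq, ?_⟩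
  have key : ∀ a b, (a, b) ∈ tomitaGraph V →
      (⟪a, ζ - q.fst⟫_ℂ).re = (⟪b, q.snd⟫_ℂ).re := by
    intro a b hab
    have := (Submodule.mem_orthogonal _ _).1 hr (WithLp.toLp 2 (a, b)) hab
    rw [WithLp.prod_inner_apply, real_inner_eq_re_inner ℂ, real_inner_eq_re_inner ℂ] at this
    simp [h1, h2] at this
    simp only [inner_sub_right, sub_re] at this ⊢
    linarith
  rintro ⟨a, b⟩ hab
  change ⟪ζ - q.fst, a⟫_ℂ = ⟪b, q.snd⟫_ℂ
  have k1 := key _ _ hab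
  -- Orthogonality is only real; testing against (ia, -ib), also in the graph, yields the imaginary
  -- parts.
  have k2 := key _ _ (tomitaGraph_I_smul hab)
  rw [inner_neg_left, inner_smul_left, inner_smul_left] at k2
  simp only [conj_I, neg_re, mul_re, neg_im, I_re, I_im] at k2
  rw [← inner_conj_symm]
  refine Complex.ext ?_ ?_
  · rw [conj_re]
    exact k1
  · rw [conj_im]
    linarith

/-- The domain of `T* T` is a core for `T`. -/
theorem closure_tomitaCore (hV : IsClosed (V : Set H)) (hs : IsSeparatingSubspace V) :
    (tomitaCore V).topologicalClosure = tomitaSubmodule V := by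
  let _ : InnerProductSpace ℝ H := InnerProductSpace.complexToReal
  have hle : (tomitaCore V).topologicalClosure ≤ tomitaSubmodule V :=
    Submodule.topologicalClosure_minimal _ (fun p hp => hp.1) (isClosed_tomitaSubmodule hV)
  have : CompleteSpace (tomitaCore V).topologicalClosure :=
    (Submodule.isClosed_topologicalClosure _).completeSpace_coe
  have h := Submodule.sup_orthogonal_inf_of_hasOrthogonalProjection (𝕜 := ℝ) hle
  suffices (tomitaCore V).topologicalClosureᗮ ⊓ tomitaSubmodule V = ⊥ by
    rwa [this, sup_bot_eq] at h
  rw [Submodule.orthogonal_closure, eq_bot_iff]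
  rintro p ⟨hp1, hp2⟩
  -- Let p in the graph be orthogonal to the core, and solve (1 + T*T)q = p.fst. Pairing p with (q,
  -- Tq) gives ‖p.fst‖² = 0.
  obtain ⟨q, r, hqr, hadj⟩ := exists_add_modularOperator_eq hV p.fst
  have h1 := (Submodule.mem_orthogonal _ _).1 hp1 (WithLp.toLp 2 (q, r)) ⟨hqr, _, hadj⟩
  rw [WithLp.prod_inner_apply, real_inner_eq_re_inner ℂ, real_inner_eq_re_inner ℂ] at h1
  have h2 := hadj _ hp2
  have h3 : (⟪p.fst - q, p.fst⟫_ℂ).re = (⟪r, p.snd⟫_ℂ).re := by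
    rw [h2, ← inner_conj_symm, conj_re]
  have h4 : (⟪p.fst, p.fst⟫_ℂ).re = 0 := by
    rw [inner_sub_left, sub_re] at h3
    simp at h1
    linarith
  have h5 : p.fst = 0 := by
    have h5 : (⟪p.fst, p.fst⟫_ℂ).re = ‖p.fst‖ ^ 2 := inner_self_eq_norm_sq (𝕜 := ℂ) p.fst
    rw [h4] at h5
    exact norm_eq_zero.1 (pow_eq_zero_iff two_ne_zero |>.1 h5.symm)
  -- The separating property makes T single-valued, so a vanishing first component forces the second
  -- to vanish.
  obtain ⟨a, ha, b, hb, h6, h7⟩ := hp2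
  simp only [h5] at h6
  have h8 : a = I • (-b) := by rw [smul_neg]; exact eq_neg_of_add_eq_zero_left h6.symm
  have h9 : a = 0 := hs a ha _ (V.neg_mem hb) h8
  have h10 : I • b = 0 := by rw [h9] at h6; simpa using h6.symm
  have h11 : p.snd = 0 := by simp only at h7; rw [h7, h9, h10, sub_zero]
  rw [Submodule.mem_bot]
  exact (WithLp.ofLp_injective 2) (Prod.ext h5 h11)

/-- A standard subspace with modular operator `e^{2 π i A}` is contained in the domain of the square
root `e^{π i A}`. -/
theorem IsUnitaryOneParam.exists_mem_imaginaryExpGraph (hu : IsUnitaryOneParam u)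
    (hV : IsClosed (V : Set H)) (hs : IsSeparatingSubspace V)
    (hΔ : modularOperatorGraph V = imaginaryExpGraph u (2 * Real.pi)) (hv : v ∈ V) :
    ∃ η, (v, η) ∈ imaginaryExpGraph u Real.pi := by
  have hmem : WithLp.toLp 2 (v, v) ∈ (tomitaCore V).topologicalClosure := by
    rw [closure_tomitaCore hV hs]
    exact ⟨v, hv, 0, V.zero_mem, by simp, by simp⟩
  obtain ⟨p, hp, hlim⟩ := mem_closure_iff_seq_limit.1 hmem
  choose hT ζ hζ using hp
  have hfst : Tendsto (fun n => (p n).fst) atTop (𝓝 v) :=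
    ((WithLp.prod_continuous_ofLp 2 H H).fst.tendsto _).comp hlim
  have hsnd : Tendsto (fun n => (p n).snd) atTop (𝓝 v) :=
    ((WithLp.prod_continuous_ofLp 2 H H).snd.tendsto _).comp hlim
  have hΔ' : ∀ n, ∃ η, ((p n).fst, η) ∈ imaginaryExpGraph u Real.pi ∧
      (η, ζ n) ∈ imaginaryExpGraph u Real.pi := by
    intro n
    refine hu.exists_imaginaryExpGraph_of_add Real.pi_pos Real.pi_pos ?_
    rw [← two_mul, ← hΔ]
    exact ⟨_, hT n, hζ n⟩
  choose η hη hη' using hΔ'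
  -- On the domain of T*T both ‖e^{πiA}a‖² and ‖Ta‖² equal ⟪T*Ta, a⟫. Thus a sequence of the core
  -- converging in the graph norm of T also has Cauchy images under e^{πiA}.
  have hdist : ∀ m n, dist (η m) (η n) = dist (p m).snd (p n).snd := by
    intro m n
    have h1 := hu.inner_imaginaryExpGraph Real.pi_pos
      (hu.imaginaryExpGraph_sub (hη m) (hη n)) (hu.imaginaryExpGraph_sub (hη' m) (hη' n))
    have h2 := (antilinearAdjointGraph_sub (hζ m) (hζ n)) _
      (tomitaGraph_add (hT m) (tomitaGraph_smul (-1) (hT n)))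
    simp only [Prod.mk_sub_mk, neg_smul, one_smul,
      ← sub_eq_add_neg] at h2
    rw [← inner_conj_symm, ← h1, inner_conj_symm] at h2
    rw [dist_eq_norm, dist_eq_norm, @norm_eq_sqrt_re_inner ℂ, h2, ← @norm_eq_sqrt_re_inner ℂ]
  have hcauchy : CauchySeq η := by
    rw [Metric.cauchySeq_iff]
    intro ε hε
    obtain ⟨N, hN⟩ := Metric.cauchySeq_iff.1 hsnd.cauchySeq ε hε
    exact ⟨N, fun m hm n hn => by rw [hdist]; exact hN m hm n hn⟩
  obtain ⟨x, hx⟩ := cauchySeq_tendsto_of_complete hcauchy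
  exact ⟨x, hu.mem_imaginaryExpGraph_of_tendsto Real.pi_pos hη hfst hx⟩

end ModularTheory

/-! ### A formula for the derivative of the adjoint action in a chart -/

section Calculus

open Filter Topology VectorField

variable {E : Type*} [NormedAddCommGroup E] [NormedSpace ℝ E]

theorem fderiv_apply_left {m : E × E → E} {a b : E} (hm : DifferentiableAt ℝ m (a, b)) :
    fderiv ℝ (fun a' => m (a', b)) a = (fderiv ℝ m (a, b)).comp (.inl ℝ E E) :=
  (hm.hasFDerivAt.comp a (hasFDerivAt_prodMk_left a b)).fderiv

theorem fderiv_apply_right {m : E × E → E} {a b : E} (hm : DifferentiableAt ℝ m (a, b)) :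
    fderiv ℝ (fun b' => m (a, b')) b = (fderiv ℝ m (a, b)).comp (.inr ℝ E E) :=
  (hm.hasFDerivAt.comp b (hasFDerivAt_prodMk_right a b)).fderiv

/-- Let `m` be a local multiplication with unit `e`, and `K (a, b) = a b a⁻¹`. If the curve `c` has
velocity `v` at `e`, then the derivative of `Ad (c t) w` is the Lie bracket of the left invariant
vector fields defined by `v` and `w`. -/
theorem hasDerivAt_adjoint_of_localMul {m K : E × E → E} {e : E} (hm : ContDiffAt ℝ 2 m (e, e))
    (hK : ContDiffAt ℝ 2 K (e, e)) (hKe : ∀ᶠ a in 𝓝 e, K (a, e) = e)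
    (hme : ∀ᶠ b in 𝓝 e, m (e, b) = b) (hme' : ∀ᶠ a in 𝓝 e, m (a, e) = a)
    (hmK : ∀ᶠ p in 𝓝 (e, e), m (K p, p.1) = m p) {c : ℝ → E} {v w : E} (hc0 : c 0 = e)
    (hc : HasDerivAt c v 0) :
    HasDerivAt (fun t => fderiv ℝ (fun b => K (c t, b)) e w)
      (lieBracket ℝ (fun a => fderiv ℝ (fun b => m (a, b)) e v)
        (fun a => fderiv ℝ (fun b => m (a, b)) e w) e) 0 := by
  have hmd : ∀ᶠ p in 𝓝 (e, e), DifferentiableAt ℝ m p :=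
    (hm.eventually (by simp)).mono fun p hp => hp.differentiableAt (by simp)
  have hKd : ∀ᶠ p in 𝓝 (e, e), DifferentiableAt ℝ K p :=
    (hK.eventually (by simp)).mono fun p hp => hp.differentiableAt (by simp)
  have hDm : DifferentiableAt ℝ (fderiv ℝ m) (e, e) :=
    (hm.fderiv_right (m := 1) (by norm_num)).differentiableAt (by simp)
  have hDK : DifferentiableAt ℝ (fderiv ℝ K) (e, e) :=
    (hK.fderiv_right (m := 1) (by norm_num)).differentiableAt (by simp)
  have hi : Tendsto (fun a : E => (a, e)) (𝓝 e) (𝓝 (e, e)) :=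
    (Continuous.prodMk_left e).tendsto e
  have hi' : Tendsto (fun a : E => (e, a)) (𝓝 e) (𝓝 (e, e)) :=
    (Continuous.prodMk_right e).tendsto e
  set D := fderiv ℝ m with hD
  set D2 := fderiv ℝ D (e, e)
  set Y : E → E := fun a => fderiv ℝ K (a, e) (0, w) with hY
  have hX : ∀ x, (fun a => fderiv ℝ (fun b => m (a, b)) e x) =ᶠ[𝓝 e] fun a => D (a, e) (0, x) := by
    intro x
    filter_upwards [hi.eventually hmd] with a ha
    rw [fderiv_apply_right ha]; simp [hD]
  have hX' : ∀ x, HasFDerivAt (fun a => D (a, e) (0, x))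
      ((ContinuousLinearMap.apply ℝ E ((0, x) : E × E)).comp (D2.comp (.inl ℝ E E))) e := by
    intro x
    have h1 : HasFDerivAt (fun a => D (a, e)) (D2.comp (.inl ℝ E E)) e :=
      hDm.hasFDerivAt.comp e (f := fun a => (a, e)) (hasFDerivAt_prodMk_left e e)
    exact (ContinuousLinearMap.apply ℝ E ((0, x) : E × E)).hasFDerivAt.comp e h1
  have hXe : ∀ x, D (e, e) (0, x) = x := by
    intro x
    have h1 := fderiv_apply_right hmd.self_of_nhds
    rw [(show (fun b => m (e, b)) =ᶠ[𝓝 e] id from hme).fderiv_eq, fderiv_id] at h1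
    have := congrArg (fun L : E →L[ℝ] E => L x) h1
    simpa using this.symm
  have hXe' : ∀ x, D (e, e) (x, 0) = x := by
    intro x
    have h1 := fderiv_apply_left hmd.self_of_nhds
    rw [(show (fun a => m (a, e)) =ᶠ[𝓝 e] id from hme').fderiv_eq, fderiv_id] at h1
    have := congrArg (fun L : E →L[ℝ] E => L x) h1
    simpa using this.symm
  have hYd : DifferentiableAt ℝ Y e :=
    ((ContinuousLinearMap.apply ℝ E ((0, w) : E × E)).differentiableAt.comp e
      (DifferentiableAt.comp e (f := fun a => (a, e)) hDK (by fun_prop)))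
  -- Derivative in b, at b = e and in the direction w, of the identity K(a, b) · a = a · b.
  have hkey : ∀ᶠ a in 𝓝 e, D (e, a) (Y a, 0) = D (a, e) (0, w) := by
    filter_upwards [hi.eventually hmd, hi'.eventually hmd, hi.eventually hKd, hKe,
      hi.eventually hmK.eventually_nhds] with a h1 h2 h3 h4 h5
    have e1 : HasFDerivAt (fun b => m (K (a, b), a))
        ((D (e, a)).comp ((.inl ℝ E E : E →L[ℝ] E × E).comp
          ((fderiv ℝ K (a, e)).comp (.inr ℝ E E)))) e := by
      have h6 := h3.hasFDerivAt.comp e (hasFDerivAt_prodMk_right a e)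
      have h7 : HasFDerivAt (fun k => m (k, a)) ((D (e, a)).comp (.inl ℝ E E)) (K (a, e)) := by
        rw [h4]
        exact h2.hasFDerivAt.comp e (f := fun k => (k, a)) (hasFDerivAt_prodMk_left e a)
      exact HasFDerivAt.comp e (g := fun k => m (k, a)) (f := fun b => K (a, b)) h7 h6
    have e2 : HasFDerivAt (fun b => m (a, b)) ((D (a, e)).comp (.inr ℝ E E)) e :=
      h1.hasFDerivAt.comp e (hasFDerivAt_prodMk_right a e)
    have e3 : (fun b => m (K (a, b), a)) =ᶠ[𝓝 e] fun b => m (a, b) :=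
      ((Continuous.prodMk_right a).tendsto e).eventually h5
    have e4 := (e1.congr_of_eventuallyEq e3.symm).unique e2
    simpa [hY] using congrArg (fun L : E →L[ℝ] E => L w) e4
  have hYe : Y e = w := by
    have := hkey.self_of_nhds
    rwa [hXe', hXe] at this
  have hsymm : D2 (0, v) (w, 0) = D2 (w, 0) (0, v) :=
    (hm.isSymmSndFDerivAt (by simp)).eq _ _
  -- Differentiating the previous identity at e along v gives D²m(0,v)(w,0) + Y'(v) = D²m(v,0)(0,w);
  -- symmetry of D²m swaps the arguments in the first term.
  have hY' : fderiv ℝ Y e v = D2 (v, 0) (0, w) - D2 (w, 0) (0, v) := by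
    have h1 : HasFDerivAt (fun a => D (e, a)) (D2.comp (.inr ℝ E E)) e :=
      hDm.hasFDerivAt.comp e (hasFDerivAt_prodMk_right e e)
    have h2 : HasFDerivAt (fun a => (Y a, (0 : E))) ((fderiv ℝ Y e).prod 0) e :=
      hYd.hasFDerivAt.prodMk (hasFDerivAt_const _ _)
    have h3 := (h1.clm_apply h2).congr_of_eventuallyEq (hkey.mono fun a h => h.symm)
    have h4 := congrArg (fun L : E →L[ℝ] E => L v) (h3.unique (hX' w))
    simp [hYe, hXe', hsymm] at h4
    rw [← h4, add_sub_cancel_right]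
  have hbr : lieBracket ℝ (fun a => fderiv ℝ (fun b => m (a, b)) e v)
      (fun a => fderiv ℝ (fun b => m (a, b)) e w) e = fderiv ℝ Y e v := by
    rw [lieBracket_eq]
    beta_reduce
    have h1 : ∀ x, fderiv ℝ (fun b => m (e, b)) e x = x := fun x =>
      ((hX x).self_of_nhds).trans (hXe x)
    rw [(hX v).fderiv_eq, (hX w).fderiv_eq, h1, h1, (hX' v).fderiv, (hX' w).fderiv, hY']
    simp
  rw [hbr]
  have h1 : HasDerivAt (fun t => Y (c t)) (fderiv ℝ Y e v) 0 := by
    have h2 : HasFDerivAt Y (fderiv ℝ Y e) (c 0) := by rw [hc0]; exact hYd.hasFDerivAt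
    exact h2.comp_hasDerivAt 0 hc
  refine h1.congr_of_eventuallyEq ?_
  have hct : Tendsto c (𝓝 0) (𝓝 e) := hc0 ▸ hc.continuousAt.tendsto
  filter_upwards [hct.eventually (hi.eventually hKd)] with t ht
  rw [fderiv_apply_right ht]
  simp [hY]

end Calculus

/-! ### One-parameter subgroups of Lie groups -/

section OneParam

open Filter Topology VectorField

variable {E : Type*} [NormedAddCommGroup E] [NormedSpace ℝ E] [FiniteDimensional ℝ E]
  {G : Type*} [TopologicalSpace G] [ChartedSpace E G] [Group G] [LieGroup 𝓘(ℝ, E) ∞ G]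

theorem mdifferentiableAt_leftTranslation (a b : G) :
    MDifferentiableAt 𝓘(ℝ, E) 𝓘(ℝ, E) (fun y : G => a * y) b :=
  (contMDiff_mul_left (I := 𝓘(ℝ, E)) (n := ∞) (a := a)).mdifferentiableAt (by simp)

theorem contMDiff_one_mulInvariantVectorField (x : GroupLieAlgebra 𝓘(ℝ, E) G) :
    ContMDiff 𝓘(ℝ, E) 𝓘(ℝ, E).tangent 1
      (fun g : G => (⟨g, mulInvariantVectorField x g⟩ : TangentBundle 𝓘(ℝ, E) G)) := by
  refine (contMDiff_mulInvariantVectorField x).of_le ?_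
  rw [minSmoothness_of_isRCLikeNormedField]
  norm_num

/-- The differential of a homomorphism maps left invariant vector fields to left invariant ones. -/
theorem mfderiv_monoidHom_mulInvariantVectorField (f : G →* G)
    (hf : ContMDiff 𝓘(ℝ, E) 𝓘(ℝ, E) ∞ f) (x : GroupLieAlgebra 𝓘(ℝ, E) G) (g : G) :
    (mfderiv 𝓘(ℝ, E) 𝓘(ℝ, E) f g (mulInvariantVectorField x g) : E) =
      mulInvariantVectorField (mfderiv 𝓘(ℝ, E) 𝓘(ℝ, E) f 1 x : E) (f g) := by
  have hd : ∀ g, MDifferentiableAt 𝓘(ℝ, E) 𝓘(ℝ, E) f g := fun g => hf.mdifferentiableAt (by simp)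
  -- Every tangent space is the model space E, so the derivative at g also serves at base points
  -- equal to g, here g * 1.
  have hA : ∀ b : G, b = g → HasMFDerivAt 𝓘(ℝ, E) 𝓘(ℝ, E) f b
      (mfderiv 𝓘(ℝ, E) 𝓘(ℝ, E) f g : E →L[ℝ] E) := by
    rintro b rfl
    exact (hd b).hasMFDerivAt
  have hB := (hA (g * 1) (mul_one g)).comp (1 : G) (mdifferentiableAt_leftTranslation g 1).hasMFDerivAt
  have hC : ∀ b : G, b = 1 → HasMFDerivAt 𝓘(ℝ, E) 𝓘(ℝ, E) (fun y : G => f g * y) b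
      (mfderiv 𝓘(ℝ, E) 𝓘(ℝ, E) (fun y : G => f g * y) 1 : E →L[ℝ] E) := by
    rintro b rfl
    exact (mdifferentiableAt_leftTranslation _ _).hasMFDerivAt
  have hD := (hC (f 1) (map_one f)).comp (1 : G) (hd 1).hasMFDerivAt
  have hE : f ∘ (fun y => g * y) = (fun y => f g * y) ∘ f := by funext y; simp
  rw [hE] at hB
  exact congrArg (fun L : E →L[ℝ] E => L x) (hasMFDerivAt_unique hB hD)

variable [T2Space G]

theorem expCurve_zero (x : GroupLieAlgebra 𝓘(ℝ, E) G) : expCurve x 0 = (1 : G) :=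
  (exists_oneParam x).choose_spec.1

theorem isMIntegralCurve_expCurve (x : GroupLieAlgebra 𝓘(ℝ, E) G) :
    IsMIntegralCurve (I := 𝓘(ℝ, E)) (expCurve x) (mulInvariantVectorField x) :=
  (exists_oneParam x).choose_spec.2

theorem continuous_expCurve (x : GroupLieAlgebra 𝓘(ℝ, E) G) :
    Continuous (expCurve x : ℝ → G) :=
  continuous_iff_continuousAt.2 fun t => (isMIntegralCurve_expCurve x t).continuousAt

theorem eq_expCurve {x : GroupLieAlgebra 𝓘(ℝ, E) G} {γ : ℝ → G}
    (hγ : IsMIntegralCurve (I := 𝓘(ℝ, E)) γ (mulInvariantVectorField x)) (h0 : γ 0 = 1) :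
    γ = expCurve x :=
  isMIntegralCurve_Ioo_eq_of_contMDiff_boundaryless (t₀ := 0)
    (contMDiff_one_mulInvariantVectorField x) hγ (isMIntegralCurve_expCurve x)
    (h0.trans (expCurve_zero x).symm)

theorem expCurve_add (x : GroupLieAlgebra 𝓘(ℝ, E) G) (s t : ℝ) :
    (expCurve x (s + t) : G) = expCurve x s * expCurve x t := by
  have h1 := (isMIntegralCurve_expCurve x).comp_add s
  have h2 : IsMIntegralCurve (I := 𝓘(ℝ, E)) (fun t => expCurve x s * expCurve x t)
      (mulInvariantVectorField x) := by
    rw [isMIntegralCurve_iff_isMIntegralCurveOn]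
    exact ((isMIntegralCurve_expCurve x).isMIntegralCurveOn univ).mul_left_invariant _
  have h3 := isMIntegralCurve_Ioo_eq_of_contMDiff_boundaryless (t₀ := 0)
    (contMDiff_one_mulInvariantVectorField x) h1 h2 (by simp [expCurve_zero])
  have := congrFun h3 t
  simpa [add_comm] using this

theorem expCurve_smul (x : GroupLieAlgebra 𝓘(ℝ, E) G) (c t : ℝ) :
    (expCurve (c • x) t : G) = expCurve x (t * c) := by
  have h1 := (isMIntegralCurve_expCurve x).comp_mul c
  rw [← mulInvariantVectorField_smul] at h1
  exact (congrFun (eq_expCurve h1 (by simp [expCurve_zero])) t).symm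

theorem map_expCurve (f : G →* G) (hf : ContMDiff 𝓘(ℝ, E) 𝓘(ℝ, E) ∞ f)
    (x : GroupLieAlgebra 𝓘(ℝ, E) G) (t : ℝ) :
    f (expCurve x t) = expCurve (mfderiv 𝓘(ℝ, E) 𝓘(ℝ, E) f 1 x : E) t := by
  have h1 : IsMIntegralCurve (I := 𝓘(ℝ, E)) (fun t => f (expCurve x t))
      (mulInvariantVectorField (mfderiv 𝓘(ℝ, E) 𝓘(ℝ, E) f 1 x : E)) := by
    intro t
    have h2 := (hf.mdifferentiableAt (by simp) (x := expCurve x t)).hasMFDerivAt.comp t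
      (isMIntegralCurve_expCurve x t)
    have h3 : ∀ (A : E →L[ℝ] E) (w : E), A.comp ((1 : ℝ →L[ℝ] ℝ).smulRight w) =
        (1 : ℝ →L[ℝ] ℝ).smulRight (A w) := by
      intro A w
      ext
      simp
    have h4 := mfderiv_monoidHom_mulInvariantVectorField f hf x (expCurve x t)
    rw [← h4]
    exact (h3 _ _) ▸ h2
  exact congrFun (eq_expCurve h1 (by simp [expCurve_zero])) t

end OneParam

/-! ### The group structure in a chart at the identity -/

section Chart

open Filter Topology VectorField

variable {E : Type*} [NormedAddCommGroup E] [NormedSpace ℝ E]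
  {G : Type*} [TopologicalSpace G] [ChartedSpace E G] [Group G]

/-- The multiplication in the chart at the identity. -/
noncomputable def chartMul (G : Type*) [TopologicalSpace G] [ChartedSpace E G] [Group G] :
    E × E → E := fun p =>
  extChartAt 𝓘(ℝ, E) (1 : G) ((extChartAt 𝓘(ℝ, E) (1 : G)).symm p.1 *
    (extChartAt 𝓘(ℝ, E) (1 : G)).symm p.2)

/-- The conjugation `(a, b) ↦ a b a⁻¹` in the chart at the identity. -/
noncomputable def chartConj (G : Type*) [TopologicalSpace G] [ChartedSpace E G] [Group G] :
    E × E → E := fun p =>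
  extChartAt 𝓘(ℝ, E) (1 : G) ((extChartAt 𝓘(ℝ, E) (1 : G)).symm p.1 *
    (extChartAt 𝓘(ℝ, E) (1 : G)).symm p.2 * ((extChartAt 𝓘(ℝ, E) (1 : G)).symm p.1)⁻¹)

/-- The coordinates of the identity. -/
noncomputable def chartOne (G : Type*) [TopologicalSpace G] [ChartedSpace E G] [Group G] : E :=
  extChartAt 𝓘(ℝ, E) (1 : G) 1

variable [FiniteDimensional ℝ E] [LieGroup 𝓘(ℝ, E) ∞ G]

local notation "φ" => extChartAt 𝓘(ℝ, E) (1 : G)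
local notation "e₁" => (chartOne G : E)

theorem chart_symm_one : (φ).symm e₁ = 1 := extChartAt_to_inv (I := 𝓘(ℝ, E)) (1 : G)

theorem eventually_chart_symm : ∀ᶠ g in 𝓝 (1 : G), (φ).symm (φ g) = g :=
  Filter.mem_of_superset (extChartAt_source_mem_nhds (I := 𝓘(ℝ, E)) (1 : G))
    fun _ hg => (φ).left_inv hg

theorem eventually_chart : ∀ᶠ a in 𝓝 e₁, φ ((φ).symm a) = a :=
  Filter.mem_of_superset (extChartAt_target_mem_nhds (I := 𝓘(ℝ, E)) (1 : G))
    fun _ ha => (φ).right_inv ha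

theorem tendsto_chart_symm : Tendsto (φ).symm (𝓝 e₁) (𝓝 1) := by
  have := (continuousAt_extChartAt_symm (I := 𝓘(ℝ, E)) (1 : G)).tendsto
  rwa [extChartAt_to_inv] at this

theorem tendsto_chart : Tendsto φ (𝓝 (1 : G)) (𝓝 e₁) :=
  (continuousAt_extChartAt (I := 𝓘(ℝ, E)) (1 : G)).tendsto

theorem contMDiffAt_chart_symm_comp {E' : Type*} [NormedAddCommGroup E'] [NormedSpace ℝ E']
    {f : E' → E} {x : E'} (hf : ContDiffAt ℝ ∞ f x) (hx : f x = e₁) :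
    ContMDiffAt 𝓘(ℝ, E') 𝓘(ℝ, E) ∞ (fun y => (φ).symm (f y)) x := by
  have h1 : ContMDiffAt 𝓘(ℝ, E) 𝓘(ℝ, E) ∞ (φ).symm (f x) := by
    rw [hx]
    exact (contMDiffOn_extChartAt_symm (1 : G)).contMDiffAt (extChartAt_target_mem_nhds (1 : G))
  exact h1.comp x hf.contMDiffAt

theorem contDiffAt_chart_comp {E' : Type*} [NormedAddCommGroup E'] [NormedSpace ℝ E']
    {f : E' → G} {x : E'} (hf : ContMDiffAt 𝓘(ℝ, E') 𝓘(ℝ, E) ∞ f x) (hx : f x = 1) :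
    ContDiffAt ℝ ∞ (fun y => φ (f y)) x := by
  rw [← contMDiffAt_iff_contDiffAt]
  have h1 : ContMDiffAt 𝓘(ℝ, E) 𝓘(ℝ, E) ∞ φ (f x) := by
    rw [hx]
    exact contMDiffAt_extChartAt
  exact h1.comp x hf

theorem contDiffAt_chartMul : ContDiffAt ℝ ∞ (chartMul G) (e₁, e₁) := by
  refine contDiffAt_chart_comp (G := G) (ContMDiffAt.mul (contMDiffAt_chart_symm_comp contDiffAt_fst rfl)
    (contMDiffAt_chart_symm_comp contDiffAt_snd rfl)) ?_
  simp only [chart_symm_one, mul_one]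

theorem contDiffAt_chartConj : ContDiffAt ℝ ∞ (chartConj G) (e₁, e₁) := by
  have h1 := contMDiffAt_chart_symm_comp (G := G) (x := (e₁, e₁)) contDiffAt_fst rfl
  have h2 := contMDiffAt_chart_symm_comp (G := G) (x := (e₁, e₁)) contDiffAt_snd rfl
  refine contDiffAt_chart_comp (G := G) ((h1.mul h2).mul h1.inv) ?_
  simp only [chart_symm_one, mul_one, inv_one]

theorem chartMul_one_left : ∀ᶠ b in 𝓝 e₁, chartMul G (e₁, b) = b :=
  eventually_chart.mono fun b hb => by simp only [chartMul, chart_symm_one, one_mul, hb]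

theorem chartMul_one_right : ∀ᶠ a in 𝓝 e₁, chartMul G (a, e₁) = a :=
  eventually_chart.mono fun b hb => by simp only [chartMul, chart_symm_one, mul_one, hb]

theorem chartConj_one_right (a : E) : chartConj G (a, e₁) = e₁ := by
  simp only [chartConj, chart_symm_one, mul_one, mul_inv_cancel]
  rfl

theorem chartMul_chartConj :
    ∀ᶠ p in 𝓝 (e₁, e₁), chartMul G (chartConj G p, p.1) = chartMul G p := by
  have h : Tendsto (fun p : E × E => (φ).symm p.1 * (φ).symm p.2 * ((φ).symm p.1)⁻¹)
      (𝓝 (e₁, e₁)) (𝓝 1) := by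
    have h1 := (tendsto_chart_symm (E := E) (G := G)).comp (continuous_fst.tendsto (e₁, e₁))
    have h2 := (tendsto_chart_symm (E := E) (G := G)).comp (continuous_snd.tendsto (e₁, e₁))
    have : IsTopologicalGroup G := topologicalGroup_of_lieGroup 𝓘(ℝ, E) ∞
    simpa using (h1.mul h2).mul h1.inv
  filter_upwards [h.eventually (eventually_chart_symm (E := E))] with p hp
  simp only [chartMul, chartConj, hp, inv_mul_cancel_right]

theorem hasFDerivAt_chart_of_hasMFDerivAt {f : G → G} (hf1 : f 1 = 1) {A : E →L[ℝ] E}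
    (hf : HasMFDerivAt 𝓘(ℝ, E) 𝓘(ℝ, E) f 1 A) :
    HasFDerivAt (fun b => φ (f ((φ).symm b))) A e₁ := by
  have h := hf.2
  simp only [writtenInExtChartAt, hf1, modelWithCornersSelf_coe, range_id] at h
  exact h.hasFDerivAt_of_univ

theorem hasFDerivAt_comp_chart_symm {f : G → E} {A : E →L[ℝ] E}
    (hf : HasMFDerivAt 𝓘(ℝ, E) 𝓘(ℝ, E) f 1 A) : HasFDerivAt (fun b => f ((φ).symm b)) A e₁ := by
  have h := hf.2
  simp only [writtenInExtChartAt, modelWithCornersSelf_coe, range_id] at h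
  exact h.hasFDerivAt_of_univ

theorem hasDerivAt_chart_of_hasMFDerivAt {c : ℝ → G} (hc0 : c 0 = 1) {v : E}
    (hc : HasMFDerivAt 𝓘(ℝ, ℝ) 𝓘(ℝ, E) c 0 ((1 : ℝ →L[ℝ] ℝ).smulRight v : ℝ →L[ℝ] E)) :
    HasDerivAt (fun t => φ (c t)) v 0 := by
  have h := hc.2
  simp only [writtenInExtChartAt, hc0, modelWithCornersSelf_coe, range_id] at h
  have h1 : HasFDerivAt (fun t => φ (c t)) ((1 : ℝ →L[ℝ] ℝ).smulRight v : ℝ →L[ℝ] E) 0 :=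
    h.hasFDerivAt_of_univ
  simpa using h1.hasDerivAt

/-- The Lie bracket in terms of the multiplication in the chart at the identity. -/
theorem bracket_eq_lieBracket_chartMul (v w : GroupLieAlgebra 𝓘(ℝ, E) G) :
    (⁅v, w⁆ : GroupLieAlgebra 𝓘(ℝ, E) G) = lieBracket ℝ (fun a => fderiv ℝ (fun b => chartMul G (a, b)) e₁ (v : E))
      (fun a => fderiv ℝ (fun b => chartMul G (a, b)) e₁ (w : E)) e₁ := by
  -- In the chart, the left invariant vector field of x is the derivative at the identity of b ↦
  -- m(a, b) in the direction x.
  have hpull : ∀ x : GroupLieAlgebra 𝓘(ℝ, E) G,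
      (mpullbackWithin 𝓘(ℝ, E) 𝓘(ℝ, E) (φ).symm (mulInvariantVectorField x) (range 𝓘(ℝ, E)) : E → E)
        =ᶠ[𝓝 e₁] fun a => fderiv ℝ (fun b => chartMul G (a, b)) e₁ (x : E) := by
    intro x
    filter_upwards [extChartAt_target_mem_nhds (I := 𝓘(ℝ, E)) (1 : G)] with a ha
    have : IsManifold 𝓘(ℝ, E) 1 G := IsManifold.of_le (n := ∞) (by norm_cast)
    set g := (φ).symm a with hg
    have hgs : g ∈ (φ).source := (φ).map_target ha
    have hinv : (mfderivWithin 𝓘(ℝ, E) 𝓘(ℝ, E) (φ).symm (range 𝓘(ℝ, E)) a).inverse =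
        mfderiv 𝓘(ℝ, E) 𝓘(ℝ, E) φ g :=
      ContinuousLinearMap.inverse_eq
        (mfderivWithin_extChartAt_symm_comp_mfderiv_extChartAt ha)
        (mfderiv_extChartAt_comp_mfderivWithin_extChartAt_symm ha)
    have hA : ∀ b : G, b = g → HasMFDerivAt 𝓘(ℝ, E) 𝓘(ℝ, E) φ b
        (mfderiv 𝓘(ℝ, E) 𝓘(ℝ, E) φ g : E →L[ℝ] E) := by
      rintro b rfl
      refine (mdifferentiableAt_extChartAt ?_).hasMFDerivAt
      rwa [← extChartAt_source 𝓘(ℝ, E)]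
    have hB := (hA (g * 1) (mul_one g)).comp (1 : G)
      (mdifferentiableAt_leftTranslation g 1).hasMFDerivAt
    obtain ⟨A, hAeq⟩ : ∃ A : E →L[ℝ] E, mfderiv 𝓘(ℝ, E) 𝓘(ℝ, E) φ g = A := ⟨_, rfl⟩
    obtain ⟨B, hBeq⟩ : ∃ B : E →L[ℝ] E, mfderiv 𝓘(ℝ, E) 𝓘(ℝ, E) (fun y => g * y) 1 = B :=
      ⟨_, rfl⟩
    rw [hAeq, hBeq] at hB
    have hD := hasFDerivAt_comp_chart_symm (A := A.comp B) hB
    have hE : ∀ L : E →L[ℝ] E, HasFDerivAt (fun b => chartMul G (a, b)) L e₁ →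
        fderiv ℝ (fun b => chartMul G (a, b)) e₁ (x : E) = L x := fun L hL => by rw [hL.fderiv]
    refine Eq.trans ?_ (hE _ hD).symm
    rw [mpullbackWithin_apply, hinv, hAeq]
    exact congrArg A (congrArg (fun L : E →L[ℝ] E => L x) hBeq)
  -- The bracket in the chart is pulled back to the tangent space at 1 by the derivative of the
  -- chart there, which is the identity.
  have hid : ∀ L : E →L[ℝ] E, L = ContinuousLinearMap.id ℝ E → ∀ X : E, L.inverse X = X := by
    rintro _ rfl X
    rw [ContinuousLinearMap.inverse_id, ContinuousLinearMap.id_apply]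
  have h := Filter.EventuallyEq.lieBracket_vectorField_eq (𝕜 := ℝ) (hpull v) (hpull w)
  have hset : (φ).symm ⁻¹' univ ∩ range 𝓘(ℝ, E) = univ := by simp
  have huniv : ∀ (V W : E → E) (S : Set E), S = univ →
      lieBracketWithin ℝ V W S e₁ = lieBracket ℝ V W e₁ := by
    rintro V W _ rfl
    rw [lieBracketWithin_univ]
  exact (hid _ mfderiv_extChartAt_self _).trans ((huniv _ _ _ hset).trans h)

end Chart

/-! ### The adjoint action and products of one-parameter groups -/

section Adjoint

open Filter Topology VectorField

variable {E : Type*} [NormedAddCommGroup E] [NormedSpace ℝ E] [FiniteDimensional ℝ E]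
  {G : Type*} [TopologicalSpace G] [ChartedSpace E G] [Group G] [LieGroup 𝓘(ℝ, E) ∞ G]

local notation "φ" => extChartAt 𝓘(ℝ, E) (1 : G)
local notation "e₁" => (chartOne G : E)

theorem contMDiff_conj (g : G) : ContMDiff 𝓘(ℝ, E) 𝓘(ℝ, E) ∞ (MulAut.conj g : G → G) := by
  have h := (contMDiff_mul_right (I := 𝓘(ℝ, E)) (n := ∞) (a := g⁻¹)).comp
    (contMDiff_mul_left (I := 𝓘(ℝ, E)) (n := ∞) (a := g))
  exact h

/-- The adjoint action of a Lie group on its Lie algebra. -/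
noncomputable def adjointAction (E : Type*) [NormedAddCommGroup E] [NormedSpace ℝ E]
    {G : Type*} [TopologicalSpace G] [ChartedSpace E G] [Group G] (g : G) : E →L[ℝ] E :=
  mfderiv 𝓘(ℝ, E) 𝓘(ℝ, E) (MulAut.conj g : G → G) 1

theorem hasMFDerivAt_conj (g : G) :
    HasMFDerivAt 𝓘(ℝ, E) 𝓘(ℝ, E) (MulAut.conj g : G → G) 1 (adjointAction E g) :=
  ((contMDiff_conj g).mdifferentiableAt (by simp)).hasMFDerivAt

theorem adjointAction_mul (g k : G) (x : E) :
    adjointAction E (g * k) x = adjointAction E g (adjointAction E k x) := by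
  have hA : ∀ b : G, b = 1 → HasMFDerivAt 𝓘(ℝ, E) 𝓘(ℝ, E) (MulAut.conj g : G → G) b
      (adjointAction E g) := by
    rintro b rfl
    exact hasMFDerivAt_conj g
  have h1 := (hA (MulAut.conj k 1) (map_one _)).comp (1 : G) (hasMFDerivAt_conj (E := E) k)
  have h2 : (MulAut.conj g : G → G) ∘ (MulAut.conj k : G → G) = (MulAut.conj (g * k) : G → G) := by
    funext y; simp
  rw [h2] at h1
  exact congrArg (fun L : E →L[ℝ] E => L x) (hasMFDerivAt_unique (hasMFDerivAt_conj (g * k)) h1)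

theorem adjointAction_one (x : E) : adjointAction E (1 : G) x = x := by
  have h1 : HasMFDerivAt 𝓘(ℝ, E) 𝓘(ℝ, E) (MulAut.conj (1 : G) : G → G) 1
      (ContinuousLinearMap.id ℝ E) := by
    have h2 : (MulAut.conj (1 : G) : G → G) = id := by funext y; simp
    rw [h2]
    exact hasMFDerivAt_id 1
  exact congrArg (fun L : E →L[ℝ] E => L x) (hasMFDerivAt_unique (hasMFDerivAt_conj 1) h1)

theorem fderiv_chartConj (a : E) :
    fderiv ℝ (fun b => chartConj G (a, b)) e₁ = adjointAction E ((φ).symm a) :=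
  (hasFDerivAt_chart_of_hasMFDerivAt (by simp) (hasMFDerivAt_conj ((φ).symm a))).fderiv

variable [T2Space G]

theorem hasDerivAt_chart_expCurve (x : GroupLieAlgebra 𝓘(ℝ, E) G) :
    HasDerivAt (fun t => φ (expCurve x t)) (x : E) 0 := by
  have h1 := isMIntegralCurve_expCurve x 0
  have h2 : ∀ g : G, g = 1 → (mulInvariantVectorField x g : E) = x := by
    rintro g rfl
    have h3 : (fun y : G => 1 * y) = id := by funext y; simp
    have h4 : HasMFDerivAt 𝓘(ℝ, E) 𝓘(ℝ, E) (fun y : G => 1 * y) 1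
        (ContinuousLinearMap.id ℝ E) := by
      rw [h3]
      exact hasMFDerivAt_id 1
    exact congrArg (fun L : E →L[ℝ] E => L x) h4.mfderiv
  refine hasDerivAt_chart_of_hasMFDerivAt (expCurve_zero x) ?_
  have h3 : ∀ z : E, (mulInvariantVectorField x (expCurve x 0 : G) : E) = z →
      HasMFDerivAt 𝓘(ℝ, ℝ) 𝓘(ℝ, E) (expCurve x : ℝ → G) 0
        ((1 : ℝ →L[ℝ] ℝ).smulRight z : ℝ →L[ℝ] E) := by
    rintro _ rfl
    exact h1
  exact h3 _ (h2 _ (expCurve_zero x))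

/-- The derivative of `Ad (exp t v) w` is `[v, w]`. -/
theorem hasDerivAt_adjointAction_expCurve (v w : GroupLieAlgebra 𝓘(ℝ, E) G) :
    HasDerivAt (fun t => adjointAction E (expCurve v t : G) w)
      (⁅v, w⁆ : GroupLieAlgebra 𝓘(ℝ, E) G) 0 := by
  have h2 : (2 : WithTop ℕ∞) ≤ ∞ := WithTop.coe_le_coe.2 le_top
  have h := hasDerivAt_adjoint_of_localMul (contDiffAt_chartMul (G := G).of_le h2)
    (contDiffAt_chartConj (G := G).of_le h2) (Eventually.of_forall chartConj_one_right)
    chartMul_one_left chartMul_one_right chartMul_chartConj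
    (c := fun t => φ (expCurve v t)) (w := w) (by rw [expCurve_zero]; rfl)
    (hasDerivAt_chart_expCurve v)
  have hbr := bracket_eq_lieBracket_chartMul v w
  refine (HasDerivAt.congr_deriv ?_ hbr.symm)
  refine h.congr_of_eventuallyEq ?_
  have hlim : Tendsto (expCurve v : ℝ → G) (𝓝 0) (𝓝 1) := by
    have := (continuous_expCurve v).tendsto 0
    rwa [expCurve_zero] at this
  filter_upwards [hlim.eventually (eventually_chart_symm (E := E))] with t ht
  rw [fderiv_chartConj, ht]

/-- Multiplicativity of Ad propagates the derivative at 0 to the equation y' = k y for all times;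
then e^{-kt} y(t) is constant. -/
theorem adjointAction_expCurve_of_hasDerivAt {v : GroupLieAlgebra 𝓘(ℝ, E) G} {w : E} {k : ℝ}
    (h1 : HasDerivAt (fun t => adjointAction E (expCurve v t : G) w) (k • w) 0) (t : ℝ) :
    adjointAction E (expCurve v t : G) w = Real.exp (k * t) • w := by
  set y : ℝ → E := fun t => adjointAction E (expCurve v t : G) w with hy
  have hder : ∀ t, HasDerivAt y (k • y t) t := by
    intro t
    have h2 : HasDerivAt y (k • w) (t - t) := by
      rw [sub_self]
      exact h1
    have h3 := ((adjointAction E (expCurve v t : G)).hasFDerivAt.comp_hasDerivAt (t - t) h2)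
    have h4 := h3.comp_sub_const t t
    rw [map_smul] at h4
    refine h4.congr_of_eventuallyEq (Eventually.of_forall fun s => ?_)
    simp only [hy, Function.comp_apply]
    rw [← adjointAction_mul, ← expCurve_add, add_sub_cancel]
  have hconst : ∀ t, HasDerivAt (fun t => Real.exp (-(k * t)) • y t) 0 t := by
    intro t
    have h1 : HasDerivAt (fun t => Real.exp (-(k * t))) (Real.exp (-(k * t)) * (-(k * 1))) t :=
      (((hasDerivAt_id t).const_mul k).neg).exp
    refine (h1.smul (hder t)).congr_deriv ?_
    rw [smul_smul, ← add_smul]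
    convert zero_smul ℝ (y t) using 2
    ring
  have h0 : y 0 = w := by simp only [hy, expCurve_zero]; exact adjointAction_one _
  have h2 := is_const_of_deriv_eq_zero (fun t => (hconst t).differentiableAt)
    (fun t => (hconst t).deriv) t 0
  simp only [mul_zero, neg_zero, Real.exp_zero, one_smul, h0] at h2
  have h3 : Real.exp (k * t) • (Real.exp (-(k * t)) • y t) = Real.exp (k * t) • w := by rw [h2]
  rwa [smul_smul, ← Real.exp_add, add_neg_cancel, Real.exp_zero, one_smul] at h3

theorem adjointAction_expCurve_of_bracket {v w : GroupLieAlgebra 𝓘(ℝ, E) G} {k : ℝ}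
    (h : ⁅v, w⁆ = k • w) (t : ℝ) :
    adjointAction E (expCurve v t : G) w = Real.exp (k * t) • (w : E) := by
  have h1 := hasDerivAt_adjointAction_expCurve v w
  rw [h] at h1
  exact adjointAction_expCurve_of_hasDerivAt h1 t

/-- If `[v, w] = k w`, then `exp (t v) exp (s w) = exp (s e^{kt} w) exp (t v)`. -/
theorem expCurve_mul_expCurve {v w : GroupLieAlgebra 𝓘(ℝ, E) G} {k : ℝ}
    (h : ⁅v, w⁆ = k • w) (t s : ℝ) :
    (expCurve v t * expCurve w s : G) =
      expCurve w (s * Real.exp (k * t)) * expCurve v t := by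
  have h1 := map_expCurve (MulAut.conj (expCurve v t : G)).toMonoidHom
    (contMDiff_conj (expCurve v t : G)) w s
  have h2 : expCurve (G := G) (mfderiv 𝓘(ℝ, E) 𝓘(ℝ, E)
      (MulAut.conj (expCurve v t : G)).toMonoidHom 1 w : E) s =
      expCurve (Real.exp (k * t) • w) s := by
    exact congrArg (fun z : E => expCurve (G := G) (z : GroupLieAlgebra 𝓘(ℝ, E) G) s)
      (adjointAction_expCurve_of_bracket h t)
  rw [h2, expCurve_smul] at h1
  rw [← h1]
  simp

end Adjoint

/-! ### Products of one-parameter groups near the identity; no small subgroups -/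

section Local

open Filter Topology

variable {E : Type*} [NormedAddCommGroup E] [NormedSpace ℝ E] [FiniteDimensional ℝ E]
  {G : Type*} [TopologicalSpace G] [ChartedSpace E G] [Group G] [LieGroup 𝓘(ℝ, E) ∞ G]

local notation "φ" => extChartAt 𝓘(ℝ, E) (1 : G)
local notation "e₁" => (chartOne G : E)

/-- The unit laws make both partial derivatives at the identity equal to the identity map. -/
theorem hasStrictFDerivAt_chartMul :
    HasStrictFDerivAt (chartMul G) (.fst ℝ E E + .snd ℝ E E) (e₁, e₁) := by
  have hm := contDiffAt_chartMul (E := E) (G := G)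
  have hd := hm.differentiableAt (by simp)
  refine (hm.hasStrictFDerivAt (by simp)).congr_fderiv ?_
  have h1 := fderiv_apply_left hd
  have h2 := fderiv_apply_right hd
  rw [EventuallyEq.fderiv_eq (f := fun a => a) (chartMul_one_right (G := G)), fderiv_fun_id] at h1
  rw [EventuallyEq.fderiv_eq (f := fun a => a) (chartMul_one_left (G := G)), fderiv_fun_id] at h2
  ext p
  · simpa using (congrArg (fun L : E →L[ℝ] E => L p) h1).symm
  · simpa using (congrArg (fun L : E →L[ℝ] E => L p) h2).symm

variable (E) in
include E in
/-- A Lie group has no small subgroups. -/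
theorem exists_nhds_one_forall_pow_mem_imp :
    ∃ N ∈ 𝓝 (1 : G), ∀ g : G, (∀ n : ℕ, g ^ n ∈ N) → g = 1 := by
  have hq : HasFDerivAt (fun a : E => chartMul G (a, a))
      (ContinuousLinearMap.id ℝ E + ContinuousLinearMap.id ℝ E) e₁ := by
    have h1 : HasFDerivAt (fun a : E => (a, a)) ((ContinuousLinearMap.id ℝ E).prod (ContinuousLinearMap.id ℝ E)) e₁ :=
      (hasFDerivAt_id _).prodMk (hasFDerivAt_id _)
    exact (hasStrictFDerivAt_chartMul (G := G)).hasFDerivAt.comp (e₁) h1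
  -- Squaring has derivative 2 at the identity; with error at most 1/2 it expands distances to the
  -- identity by at least 3/2. The powers g^(2^k) cannot stay in the unit ball unless g = 1.
  have h1 := hq.isLittleO.def (show (0 : ℝ) < 1 / 2 by norm_num)
  have h2 : ∀ᶠ a in 𝓝 e₁, ‖a - e₁‖ < 1 := by
    filter_upwards [Metric.ball_mem_nhds (e₁) one_pos] with a ha
    rwa [← dist_eq_norm]
  refine ⟨_, (eventually_chart_symm (E := E) (G := G)).and
    (tendsto_chart.eventually (h1.and h2)), fun g hg => ?_⟩
  have hs : ∀ n : ℕ, (φ).symm (φ (g ^ n)) = g ^ n := fun n => (hg n).1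
  have hb : ∀ n : ℕ, ‖φ (g ^ n) - e₁‖ < 1 := fun n => (hg n).2.2
  have hqe : chartMul G (e₁, e₁) = e₁ := (chartMul_one_left (G := G)).self_of_nhds
  have hstep : ∀ n : ℕ, 3 / 2 * ‖φ (g ^ n) - e₁‖ ≤ ‖φ (g ^ (2 * n)) - e₁‖ := by
    intro n
    have h3 := (hg n).2.1
    have h4 : chartMul G (φ (g ^ n), φ (g ^ n)) = φ (g ^ (2 * n)) := by
      simp only [chartMul, hs, two_mul, pow_add]
    rw [h4, hqe] at h3
    simp only [add_apply, ContinuousLinearMap.id_apply] at h3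
    have h5 : ‖(φ (g ^ n) - e₁) + (φ (g ^ n) - e₁)‖ = 2 * ‖φ (g ^ n) - e₁‖ := by
      rw [← two_smul ℝ, norm_smul]; simp
    have h6 := norm_sub_norm_le ((φ (g ^ n) - e₁) + (φ (g ^ n) - e₁)) (φ (g ^ (2 * n)) - e₁)
    rw [norm_sub_rev] at h3
    linarith
  have hpow : ∀ k : ℕ, (3 / 2 : ℝ) ^ k * ‖φ g - e₁‖ ≤ ‖φ (g ^ 2 ^ k) - e₁‖ := by
    intro k
    induction k with
    | zero => simp
    | succ k ih =>
      have h3 := hstep (2 ^ k)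
      rw [pow_succ' 2 k, pow_succ' (3 / 2 : ℝ) k, mul_assoc]
      exact le_trans (mul_le_mul_of_nonneg_left ih (by norm_num)) h3
  have h0 : ‖φ g - e₁‖ = 0 := by
    by_contra hne
    have hpos : 0 < ‖φ g - e₁‖ := lt_of_le_of_ne (norm_nonneg _) (Ne.symm hne)
    obtain ⟨k, hk⟩ := pow_unbounded_of_one_lt (1 / ‖φ g - e₁‖) (show (1 : ℝ) < 3 / 2 by norm_num)
    rw [div_lt_iff₀ hpos] at hk
    exact absurd ((hk.trans_le (hpow k)).trans (hb _)) (lt_irrefl _)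
  have h5 := hs 1
  rw [pow_one, sub_eq_zero.1 (norm_eq_zero.1 h0), chart_symm_one] at h5
  exact h5.symm

variable [T2Space G]

theorem tendsto_expCurve_one (x : GroupLieAlgebra 𝓘(ℝ, E) G) :
    Tendsto (expCurve x : ℝ → G) (𝓝 0) (𝓝 1) := by
  have := (continuous_expCurve x).tendsto 0
  rwa [expCurve_zero] at this

/-- By exp(sx) = exp(tx) exp((s - t)x), the velocity at t is a function of position that is
continuous at the identity. Strictness is what the local surjectivity argument needs. -/
theorem hasStrictDerivAt_chart_expCurve (x : GroupLieAlgebra 𝓘(ℝ, E) G) :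
    HasStrictDerivAt (fun t => φ (expCurve x t)) (x : E) 0 := by
  set D : E → E := fun a => fderiv ℝ (chartMul G) (a, e₁) (0, x) with hD
  have hm := contDiffAt_chartMul (E := E) (G := G)
  have hi : Tendsto (fun t : ℝ => (φ (expCurve x t), e₁)) (𝓝 0) (𝓝 (e₁, e₁)) :=
    (tendsto_chart.comp (tendsto_expCurve_one x)).prodMk_nhds tendsto_const_nhds
  have hmd : ∀ᶠ p in 𝓝 (e₁, e₁), DifferentiableAt ℝ (chartMul G) p :=
    ((hm.of_le (m := 1) (by norm_cast)).eventually (by simp)).mono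
      fun p hp => hp.differentiableAt (by simp)
  have hder : ∀ᶠ t in 𝓝 (0 : ℝ),
      HasDerivAt (fun t => φ (expCurve x t)) (D (φ (expCurve x t))) t := by
    filter_upwards [hi.eventually hmd,
      (tendsto_expCurve_one x).eventually (eventually_chart_symm (E := E))] with t ht hs
    have h1 : HasDerivAt (fun s => φ (expCurve x s)) (x : E) (t - t) := by
      rw [sub_self]
      exact hasDerivAt_chart_expCurve x
    have h2 : HasFDerivAt (fun b => chartMul G (φ (expCurve x t), b))
        ((fderiv ℝ (chartMul G) (φ (expCurve x t), e₁)).comp (.inr ℝ E E))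
        (φ (expCurve x (t - t))) := by
      rw [sub_self, expCurve_zero]
      exact ht.hasFDerivAt.comp (e₁) (hasFDerivAt_prodMk_right _ _)
    have h3 := (h2.comp_hasDerivAt (t - t) h1).comp_sub_const t t
    refine (h3.congr_of_eventuallyEq ?_).congr_deriv rfl
    have h4 : Tendsto (fun s => s - t) (𝓝 t) (𝓝 (0 : ℝ)) := by
      simpa using (continuous_sub_right t).tendsto t
    filter_upwards [h4.eventually
      ((tendsto_expCurve_one x).eventually (eventually_chart_symm (E := E)))] with s hs'
    simp only [Function.comp_apply, chartMul, hs, hs']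
    rw [← expCurve_add, add_sub_cancel]
  have hD0 : D (φ (expCurve x 0 : G)) = x := by
    rw [expCurve_zero]
    have h1 := (hasStrictFDerivAt_chartMul (E := E) (G := G)).hasFDerivAt.fderiv
    change fderiv ℝ (chartMul G) (e₁, e₁) (0, x) = x
    rw [h1]
    exact zero_add (x : E)
  have hc : ContinuousAt (fun t : ℝ => D (φ (expCurve x t))) 0 := by
    have h1 : ContinuousAt (fderiv ℝ (chartMul G)) (e₁, e₁) :=
      (hm.fderiv_right (m := 0) (by simp)).continuousAt
    have h2 := (ContinuousLinearMap.apply ℝ E ((0, x) : E × E)).continuous.continuousAt.tendsto.comp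
      (h1.tendsto.comp hi)
    have h3 : D (φ (expCurve x 0 : G)) = fderiv ℝ (chartMul G) (e₁, e₁) (0, x) := by
      rw [expCurve_zero]; rfl
    rw [ContinuousAt, h3]
    exact h2
  have h := hasStrictDerivAt_of_hasDerivAt_of_continuousAt hder hc
  rwa [hD0] at h

/-- The product of the one-parameter groups `exp (c_i(v) x_i)`, in the order given by a list of
indices. -/
noncomputable def expProd {ι : Type*} (x : ι → GroupLieAlgebra 𝓘(ℝ, E) G) (c : ι → E →L[ℝ] ℝ) :
    List ι → E → G
  | [], _ => 1
  | i :: l, v => expCurve (x i) (c i v) * expProd x c l v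

variable {ι : Type*} (x : ι → GroupLieAlgebra 𝓘(ℝ, E) G) (c : ι → E →L[ℝ] ℝ)

theorem expProd_zero (l : List ι) : expProd x c l 0 = 1 := by
  induction l with
  | nil => rfl
  | cons i l ih => rw [expProd, ih, map_zero, expCurve_zero, mul_one]

theorem continuous_expProd (l : List ι) : Continuous (expProd x c l) := by
  have : IsTopologicalGroup G := topologicalGroup_of_lieGroup 𝓘(ℝ, E) ∞
  induction l with
  | nil => exact continuous_const
  | cons i l ih => exact ((continuous_expCurve (x i)).comp (c i).continuous).mul ih

theorem tendsto_expProd (l : List ι) : Tendsto (expProd x c l) (𝓝 0) (𝓝 1) := by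
  have := (continuous_expProd x c l).tendsto 0
  rwa [expProd_zero] at this

/-- Multiplication has addition as its derivative at the identity, so the velocities of the factors
add up. -/
theorem hasStrictFDerivAt_chart_expProd (l : List ι) :
    ∃ A : E →L[ℝ] E, (∀ v, A v = (l.map fun i => c i v • (x i : E)).sum) ∧
      HasStrictFDerivAt (fun v => φ (expProd x c l v)) A 0 := by
  induction l with
  | nil => exact ⟨0, fun v => rfl, hasStrictFDerivAt_const (φ (1 : G)) 0⟩
  | cons i l ih =>
    obtain ⟨A, hA, hd⟩ := ih
    have h1 : HasStrictFDerivAt (fun v => φ (expCurve (x i) (c i v)))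
        ((c i).smulRight (x i : E)) 0 := by
      have h2 : HasStrictDerivAt (fun t => φ (expCurve (x i) t)) (x i : E) (c i 0) := by
        rw [map_zero]
        exact hasStrictDerivAt_chart_expCurve (x i)
      refine (h2.hasStrictFDerivAt.comp 0 (c i).hasStrictFDerivAt).congr_fderiv ?_
      ext v
      rfl
    have h3 : HasStrictFDerivAt (chartMul G) (.fst ℝ E E + .snd ℝ E E)
        (φ (expCurve (x i) (c i 0)), φ (expProd x c l 0)) := by
      rw [map_zero, expCurve_zero, expProd_zero]
      exact hasStrictFDerivAt_chartMul
    refine ⟨((c i).smulRight (x i : E) : E →L[ℝ] E) + A, fun v => ?_, ?_⟩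
    · rw [List.map_cons, List.sum_cons, ← hA]
      rfl
    refine ((h3.comp 0 (h1.prodMk hd)).congr_fderiv ?_).congr_of_eventuallyEq ?_
    · ext v
      rfl
    · have h4 : Tendsto (c i) (𝓝 0) (𝓝 0) := by
        simpa using (c i).continuous.tendsto 0
      filter_upwards [h4.eventually ((tendsto_expCurve_one (x i)).eventually
        (eventually_chart_symm (E := E) (G := G))),
        (tendsto_expProd x c l).eventually (eventually_chart_symm (E := E) (G := G))] with v hv hv'
      simp only [chartMul, hv, hv']
      rfl

theorem exists_basis_mem_of_span_eq_top {F : Type*} [AddCommGroup F] [Module ℝ F]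
    [FiniteDimensional ℝ F] {X : Set F} (hX : Submodule.span ℝ X = ⊤) :
    ∃ (n : ℕ) (b : Module.Basis (Fin n) ℝ F), ∀ i, b i ∈ X := by
  let b := Module.Basis.ofSpan hX.ge
  have := FiniteDimensional.fintypeBasisIndex b
  refine ⟨_, b.reindex (Fintype.equivFin _), fun i => Module.Basis.ofSpan_subset hX.ge ?_⟩
  rw [Module.Basis.reindex_apply]
  exact ⟨_, rfl⟩

/-- A Lie group is locally generated by the one-parameter groups of a spanning set of the
Lie algebra, with partial products in a given neighborhood of the identity. -/
theorem eventually_of_expCurve_mul {X : Set (GroupLieAlgebra 𝓘(ℝ, E) G)}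
    (hX : Submodule.span ℝ X = ⊤) {N : Set G} (hN : N ∈ 𝓝 1) {P : G → Prop} (h1 : P 1)
    (hmul : ∀ x ∈ X, ∀ (s : ℝ) (g : G), P g → expCurve x s * g ∈ N → P (expCurve x s * g)) :
    ∀ᶠ g in 𝓝 1, P g := by
  have hX' : Submodule.span ℝ (show Set E from X) = ⊤ := hX
  obtain ⟨n, b, hb⟩ := exists_basis_mem_of_span_eq_top hX'
  let x : Fin n → GroupLieAlgebra 𝓘(ℝ, E) G := b
  let c : Fin n → E →L[ℝ] ℝ := fun i => (b.coord i).toContinuousLinearMap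
  -- Partial products are close to 1 for small v, so each new factor keeps the product in N and
  -- `hmul` applies.
  have hP : ∀ l, ∀ᶠ v in 𝓝 0, P (expProd x c l v) := by
    intro l
    induction l with
    | nil => exact Eventually.of_forall fun _ => h1
    | cons i l ih =>
      filter_upwards [ih, (tendsto_expProd x c (i :: l)).eventually hN] with v hv hv'
      exact hmul _ (hb i) _ _ hv hv'
  obtain ⟨A, hA, hd⟩ := hasStrictFDerivAt_chart_expProd x c Finset.univ.toList
  -- With dual basis coordinates the derivative is the identity, so the products cover a
  -- neighborhood of 1.
  have hid : A.range = ⊤ := by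
    refine LinearMap.range_eq_top.2 fun v => ⟨v, ?_⟩
    refine (hA v).trans ?_
    rw [Finset.sum_map_toList]
    exact b.sum_repr v
  have hmap := hd.map_nhds_eq_of_surj hid
  have hl := (hP Finset.univ.toList).and
    ((tendsto_expProd x c Finset.univ.toList).eventually
      (eventually_chart_symm (E := E) (G := G)))
  have h2 : ∀ᶠ a in 𝓝 e₁, P ((φ).symm a) := by
    have h3 : φ (expProd x c Finset.univ.toList 0) = e₁ := by
      rw [expProd_zero]; rfl
    rw [← h3, ← hmap, eventually_map]
    exact hl.mono fun v hv => by rw [hv.2]; exact hv.1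
  filter_upwards [tendsto_chart.eventually h2, eventually_chart_symm (E := E) (G := G)] with g hg hg'
  rwa [hg'] at hg

end Local

/-! ### Antiunitary representations -/

namespace AntiunitaryRep

open Filter Topology

section Basic

variable {G : Type*} [Group G] [TopologicalSpace G] {σ : MulAut G}
  {H : Type*} [NormedAddCommGroup H] [InnerProductSpace ℂ H] (U : AntiunitaryRep σ H)

theorem op_mul (g k : G) (v : H) : U.op (g * k) v = U.op g (U.op k v) := by
  simp only [op, map_mul, LinearIsometryEquiv.coe_mul, Function.comp_apply]

theorem op_one (v : H) : U.op 1 v = v := by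
  simp only [op, map_one, LinearIsometryEquiv.coe_one, id_eq]

theorem op_inv_op (g : G) (v : H) : U.op g⁻¹ (U.op g v) = v := by
  rw [← op_mul, inv_mul_cancel, op_one]

theorem op_op_inv (g : G) (v : H) : U.op g (U.op g⁻¹ v) = v := by
  rw [← op_mul, mul_inv_cancel, op_one]

theorem op_smul (g : G) (c : ℂ) (v : H) : U.op g (c • v) = c • U.op g v := U.map_smul_inl g c v

theorem conj_conj (hσ : ∀ g, σ (σ g) = g) (v : H) : U.conj (U.conj v) = v := by
  have h1 : (⟨σ, Subgroup.mem_zpowers σ⟩ : Subgroup.zpowers σ) * ⟨σ, Subgroup.mem_zpowers σ⟩ = 1 :=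
    Subtype.ext (MulEquiv.ext hσ)
  have h2 : U.conj * U.conj = 1 := by
    rw [conj, ← map_mul, ← map_mul, h1, map_one, map_one]
  exact congrArg (fun A : H ≃ₗᵢ[ℝ] H => A v) h2

theorem conj_op (g : G) (v : H) : U.conj (U.op g v) = U.op (σ g) (U.conj v) := by
  have h1 := SemidirectProduct.inl_aut (φ := (Subgroup.zpowers σ).subtype)
    ⟨σ, Subgroup.mem_zpowers σ⟩ g
  rw [map_inv, eq_mul_inv_iff_mul_eq] at h1
  have h2 : U.op (σ g) * U.conj = U.conj * U.op g := by
    rw [conj, op, op, ← map_mul, ← map_mul, ← h1]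
    rfl
  exact (congrArg (fun A : H ≃ₗᵢ[ℝ] H => A v) h2).symm

theorem mem_translate {g : G} {V : Submodule ℝ H} {v : H} :
    v ∈ U.translate g V ↔ U.op g⁻¹ v ∈ V := by
  constructor
  · rintro ⟨w, hw, rfl⟩
    change U.op g⁻¹ (U.op g w) ∈ V
    rwa [op_inv_op]
  · exact fun h => ⟨_, h, U.op_op_inv g v⟩

theorem mem_iInf_translate {N : Set G} {V : Submodule ℝ H} {v : H} :
    v ∈ ⨅ g ∈ N, U.translate g V ↔ ∀ g ∈ N, U.op g⁻¹ v ∈ V := by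
  simp only [Submodule.mem_iInf, mem_translate]

end Basic

end AntiunitaryRep

/-! ### Comparison and translation of cyclic subspaces. -/

section Cyclic

variable {H : Type*} [NormedAddCommGroup H] [InnerProductSpace ℂ H] {V W : Submodule ℝ H}

/-- W + iW is stable under multiplication by i, so it contains V + iV as soon as it contains V. -/
theorem IsCyclicSubspace.of_forall_exists (hV : IsCyclicSubspace V)
    (h : ∀ v ∈ V, ∃ a ∈ W, ∃ b ∈ W, v = a + Complex.I • b) : IsCyclicSubspace W := by
  refine Dense.mono ?_ hV
  rintro _ ⟨v, hv, w, hw, rfl⟩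
  obtain ⟨a, ha, b, hb, rfl⟩ := h v hv
  obtain ⟨c, hc, d, hd, rfl⟩ := h w hw
  refine ⟨a - d, W.sub_mem ha hd, b + c, W.add_mem hb hc, ?_⟩
  rw [smul_add, smul_smul, Complex.I_mul_I]
  module

theorem IsCyclicSubspace.mono (hV : IsCyclicSubspace V) (h : V ≤ W) : IsCyclicSubspace W :=
  hV.of_forall_exists fun v hv => ⟨v, h hv, 0, W.zero_mem, by simp⟩

theorem IsCyclicSubspace.translate {G : Type*} [Group G] [TopologicalSpace G] {σ : MulAut G}
    (U : AntiunitaryRep σ H) (g : G) (hV : IsCyclicSubspace V) :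
    IsCyclicSubspace (U.translate g V) := by
  refine Dense.mono ?_ ((U.op g).surjective.denseRange.dense_image (U.op g).continuous hV)
  rintro _ ⟨_, ⟨a, ha, b, hb, rfl⟩, rfl⟩
  exact ⟨_, ⟨a, ha, rfl⟩, _, ⟨b, hb, rfl⟩, by simpa using U.op_smul g Complex.I b⟩

end Cyclic

namespace AntiunitaryRep

open Filter Topology

section Lie

variable {E : Type*} [NormedAddCommGroup E] [NormedSpace ℝ E] [FiniteDimensional ℝ E]
  {G : Type*} [TopologicalSpace G] [ChartedSpace E G] [Group G] [LieGroup 𝓘(ℝ, E) ∞ G]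
  [T2Space G] {τ : MulAut G} {H : Type*} [NormedAddCommGroup H] [InnerProductSpace ℂ H]
  (U : AntiunitaryRep τ H) {h : GroupLieAlgebra 𝓘(ℝ, E) G}

theorem isUnitaryOneParam (x : GroupLieAlgebra 𝓘(ℝ, E) G) :
    IsUnitaryOneParam fun t => U.op (expCurve x t) where
  map_add s t v := by rw [expCurve_add, op_mul]
  map_smul t c v := U.op_smul _ c v
  continuous v := (U.continuous_orbit v).comp (continuous_expCurve x)

end Lie

end AntiunitaryRep

/-! ### The action of the involution on eigenvectors of ad h. -/

section Lie

variable {E : Type*} [NormedAddCommGroup E] [NormedSpace ℝ E] [FiniteDimensional ℝ E]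
  {G : Type*} [TopologicalSpace G] [ChartedSpace E G] [Group G] [LieGroup 𝓘(ℝ, E) ∞ G]
  [T2Space G] {τ : MulAut G} {h : GroupLieAlgebra 𝓘(ℝ, E) G}

/-- For k in {-1, 0, 1} the eigenvalue 1 - 2k² of the differential is (-1)^k. This is the sign
produced by continuing e^{kt} to t = πi. -/
theorem IntegratesEulerInvolution.map_expCurve (hτ : IntegratesEulerInvolution h τ) {k : ℤ}
    (hk : k = -1 ∨ k = 0 ∨ k = 1) {x : GroupLieAlgebra 𝓘(ℝ, E) G} (hx : ⁅h, x⁆ = (k : ℝ) • x)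
    (s : ℝ) : τ (expCurve x s) = expCurve x ((-1) ^ k * s) := by
  have h1 := _root_.map_expCurve τ.toMonoidHom hτ.contMDiff x s
  have h2 : eulerInvolution h x = ((-1 : ℝ) ^ k) • x := by
    have h3 : eulerInvolution h x = x - (2 : ℝ) • ⁅h, ⁅h, x⁆⁆ := rfl
    rw [h3, hx, lie_smul, hx]
    rcases hk with rfl | rfl | rfl <;> norm_num <;> module
  have h3 : expCurve (G := G) (mfderiv 𝓘(ℝ, E) 𝓘(ℝ, E) τ.toMonoidHom 1 x : E) s =
      expCurve (((-1 : ℝ) ^ k) • x) s :=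
    congrArg (fun z : E => expCurve (G := G) (z : GroupLieAlgebra 𝓘(ℝ, E) G) s)
      ((hτ.mfderiv_eq x).trans h2)
  rw [h3, expCurve_smul, mul_comm] at h1
  exact h1

theorem IsEulerElement.span_eigenvectors {L : Type*} [LieRing L] [LieAlgebra ℝ L] {h : L}
    (hh : IsEulerElement h) :
    Submodule.span ℝ {x : L | ∃ k : ℤ, (k = -1 ∨ k = 0 ∨ k = 1) ∧ ⁅h, x⁆ = (k : ℝ) • x} = ⊤ := by
  rw [eq_top_iff, ← hh.2, sup_le_iff, sup_le_iff]
  refine ⟨⟨fun x hx => ?_, fun x hx => ?_⟩, fun x hx => ?_⟩ <;>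
    refine Submodule.subset_span ?_ <;> rw [Module.End.mem_eigenspace_iff] at hx
  · exact ⟨1, by simp, by simpa using hx⟩
  · exact ⟨0, by simp, by simpa using hx⟩
  · exact ⟨-1, by simp, by simpa using hx⟩

end Lie

/-! ### Regularity from cyclic intersections inside the domain of Δ^{1/2}. -/

namespace AntiunitaryRep

open Filter Topology

section Regular

variable {E : Type*} [NormedAddCommGroup E] [NormedSpace ℝ E] [FiniteDimensional ℝ E]
  {G : Type*} [TopologicalSpace G] [ChartedSpace E G] [Group G] [LieGroup 𝓘(ℝ, E) ∞ G]
  [T2Space G] {τ : MulAut G} {H : Type*} [NormedAddCommGroup H] [InnerProductSpace ℂ H]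
  [CompleteSpace H] (U : AntiunitaryRep τ H) {h : GroupLieAlgebra 𝓘(ℝ, E) G}

theorem isFixedSpace (hτ : IntegratesEulerInvolution h τ) :
    IsFixedSpace (fun t => U.op (expCurve h t)) U.conj (U.standardSubspace h) where
  isUnitaryOneParam := U.isUnitaryOneParam h
  conj_smul := U.map_smul_inr
  conj_conj := U.conj_conj hτ.involutive
  conj_comm t v := by
    rw [conj_op, hτ.map_expCurve (k := 0) (by simp) (by simp)]
    simp
  mem_iff _ := Iff.rfl

/-- If `U(g) v`, for `g` in an identity neighborhood, lies in the domain of `Δ^{1/2}`, then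
`Δ^{1/2} U(g) v = U(τ g) Δ^{1/2} v` for `g` close to the identity. -/
theorem eventually_op_mem_expGraph (hh : IsEulerElement h) (hτ : IntegratesEulerInvolution h τ)
    {N : Set G} (hN : N ∈ 𝓝 1) :
    ∀ᶠ g in 𝓝 (1 : G), ∀ v η : H, (∀ k ∈ N, ∃ ζ, (U.op k v, ζ) ∈ U.expGraph h Real.pi) →
      (v, η) ∈ U.expGraph h Real.pi → (U.op g v, U.op (τ g) η) ∈ U.expGraph h Real.pi := by
  refine eventually_of_expCurve_mul hh.span_eigenvectors hN ?_ ?_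
  · intro v η _ hη
    rwa [map_one, op_one, op_one]
  · rintro x ⟨k, hk, hx⟩ s g hg hmem v η hv hη
    -- Intertwining does not itself show that the translated vector is in the domain; this comes
    -- from the assumption on v, as partial products stay in N.
    obtain ⟨ζ, hζ⟩ := hv _ hmem
    have h1 := hg v η hv hη
    rw [op_mul] at hζ ⊢
    have h2 := (U.isUnitaryOneParam h).imaginaryExpGraph_intertwine (U.isUnitaryOneParam x) k
      (fun t s v => by rw [← op_mul, ← op_mul, expCurve_mul_expCurve hx]) h1 hζ
    rwa [map_mul, op_mul, hτ.map_expCurve hk hx, ← h2]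

/-- V' only has to lie in the domain of S = J e^{πiA}, not in V. The neighborhood for regularity
consists of the g such that U(g⁻¹) commutes with S on the vectors in question. -/
theorem isRegular_of_isCyclicSubspace (hh : IsEulerElement h) (hτ : IntegratesEulerInvolution h τ)
    {V' : Submodule ℝ H} (hV' : ∀ v ∈ V', ∃ η, (v, η) ∈ U.expGraph h Real.pi) {N : Set G}
    (hN : N ∈ 𝓝 1) (hc : IsCyclicSubspace (⨅ g ∈ N, U.translate g V')) : U.IsRegular h := by
  have : IsTopologicalGroup G := topologicalGroup_of_lieGroup 𝓘(ℝ, E) ∞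
  have hV := U.isFixedSpace hτ
  have hinv : Tendsto (fun g : G => g⁻¹) (𝓝 1) (𝓝 1) := by
    simpa using (continuous_inv (G := G)).tendsto 1
  have h1 := hinv.eventually (U.eventually_op_mem_expGraph hh hτ (hinv hN))
  refine ⟨_, h1, hc.of_forall_exists fun v hv => ?_⟩
  rw [mem_iInf_translate] at hv
  have hdom : ∀ k ∈ (fun g : G => g⁻¹) ⁻¹' N, ∃ ζ, (U.op k v, ζ) ∈ U.expGraph h Real.pi :=
    fun k hk => hV' _ (by simpa using hv _ hk)
  obtain ⟨η, hη⟩ := hdom 1 (by simpa using mem_of_mem_nhds hN)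
  rw [op_one] at hη
  -- Since J U(τ g⁻¹) = U(g⁻¹) J, this says S U(g⁻¹)v = U(g⁻¹) S v, where Sv = Jη.
  have h2 : ∀ g : G, (∀ v η : H,
      (∀ k ∈ (fun g : G => g⁻¹) ⁻¹' N, ∃ ζ, (U.op k v, ζ) ∈ U.expGraph h Real.pi) →
      (v, η) ∈ U.expGraph h Real.pi → (U.op g⁻¹ v, U.op (τ g⁻¹) η) ∈ U.expGraph h Real.pi) →
      (U.op g⁻¹ v, U.op g⁻¹ (U.conj η)) ∈ tomitaGraph (U.standardSubspace h) := by
    intro g hg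
    refine hV.mem_tomitaGraph_iff.2 ?_
    rw [conj_op, hV.conj_conj]
    exact hg v η hdom hη
  -- The components (v + Sv)/2 and (v - Sv)/(2i); by the commutation, applying U(g⁻¹) gives the
  -- corresponding components of U(g⁻¹)v, which lie in V.
  refine ⟨(2⁻¹ : ℂ) • (v + U.conj η), ?_, (2⁻¹ * -Complex.I : ℂ) • (v - U.conj η), ?_, ?_⟩
  · refine U.mem_iInf_translate.2 fun g hg => ?_
    rw [op_smul, map_add]
    exact (mem_tomitaGraph_iff.1 (h2 g hg)).1
  · refine U.mem_iInf_translate.2 fun g hg => ?_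
    rw [op_smul, map_sub]
    exact (mem_tomitaGraph_iff.1 (h2 g hg)).2
  · have hI : (Complex.I * (2⁻¹ * -Complex.I) : ℂ) = 2⁻¹ := by
      linear_combination (-2⁻¹ : ℂ) * Complex.I_mul_I
    rw [smul_smul, hI]
    module

end Regular

end AntiunitaryRep

/-! ### Nets of real subspaces -/

section Nets

open Filter Topology

variable {G : Type*} [Group G] [TopologicalSpace G] [IsTopologicalGroup G] {σ : MulAut G}
  {H : Type*} [NormedAddCommGroup H] [InnerProductSpace ℂ H] (U : AntiunitaryRep σ H)

namespace RealNet

/-- For a net satisfying (Iso), (Cov) and (RS), the intersection of the subspaces `U(g) 𝖧(W)`, with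
`g` in some identity neighborhood, is cyclic. -/
theorem exists_isCyclicSubspace_iInf_translate {N : RealNet G H} (hiso : N.Isotone)
    (hcov : N.Covariant U) (hRS : N.ReehSchlieder) {W : Opens G} (hW : (W : Set G).Nonempty) :
    ∃ M ∈ 𝓝 (1 : G), IsCyclicSubspace (⨅ g ∈ M, U.translate g (N W).toSubmodule) := by
  obtain ⟨w, hw⟩ := hW
  -- Continuity at (1, w) yields M and an open O around w with g⁻¹O ⊆ W for g in M; then U(g⁻¹)H(O)
  -- = H(g⁻¹O) ⊆ H(W).
  have hc : Tendsto (fun p : G × G => p.1⁻¹ * p.2) (𝓝 1 ×ˢ 𝓝 w) (𝓝 w) := by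
    have h1 : Continuous fun p : G × G => p.1⁻¹ * p.2 := by fun_prop
    simpa [nhds_prod_eq] using h1.tendsto (1, w)
  obtain ⟨M, hM, S, hS, hMS⟩ := mem_prod_iff.1 (hc (W.isOpen.mem_nhds hw))
  obtain ⟨O, hOS, hO, hwO⟩ := mem_nhds_iff.1 hS
  refine ⟨M, hM, (hRS ⟨O, hO⟩ ⟨w, hwO⟩).mono fun v hv => U.mem_iInf_translate.2 fun g hg => ?_⟩
  have hO' : IsOpen ((fun x => g⁻¹ * x) '' O) := isOpenMap_mul_left g⁻¹ O hO
  have h2 : U.op g⁻¹ v ∈ (N ⟨_, hO'⟩).toSubmodule := by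
    rw [← hcov g⁻¹ ⟨O, hO⟩ ⟨_, hO'⟩ rfl]
    exact ⟨v, hv, rfl⟩
  refine hiso ⟨_, hO'⟩ W ?_ h2
  rintro _ ⟨x, hx, rfl⟩
  exact hMS (mk_mem_prod hg (hOS hx))

variable (V V' : Submodule ℝ H) (W : Set G)

/-- The vectors in `U(g) V'`, `g ∈ O`, or in `U(g) V` with `g W ⊆ O`. -/
def generators (O : Opens G) : Set H :=
  {v | ∃ g ∈ O, U.op g⁻¹ v ∈ V'} ∪ {v | ∃ g : G, (∀ x ∈ W, g * x ∈ O) ∧ U.op g⁻¹ v ∈ V}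

/-- The net generated by the subspaces `U(g) V'`, associated with the points `g`, and `U(g) V`,
associated with the sets `g W`. -/
noncomputable def generated : RealNet G H := fun O =>
  ⟨(Submodule.span ℝ (generators U V V' W O)).topologicalClosure,
    Submodule.isClosed_topologicalClosure _⟩

variable {U V V' W}

theorem mem_generated {O : Opens G} {v : H} (h : v ∈ generators U V V' W O) :
    v ∈ generated U V V' W O :=
  Submodule.le_topologicalClosure _ (Submodule.subset_span h)

theorem generated_le {O : Opens G} {K : Submodule ℝ H} (hK : IsClosed (K : Set H))
    (h : generators U V V' W O ⊆ K) : (generated U V V' W O).toSubmodule ≤ K :=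
  Submodule.topologicalClosure_minimal _ (Submodule.span_le.2 h) hK

theorem generated_isotone : (generated U V V' W).Isotone := by
  refine fun O₁ O₂ hO => generated_le (generated U V V' W O₂).isClosed ?_
  rintro v (⟨g, hg, hv⟩ | ⟨g, hg, hv⟩)
  · exact mem_generated (Or.inl ⟨g, hO hg, hv⟩)
  · exact mem_generated (Or.inr ⟨g, fun x hx => hO (hg x hx), hv⟩)

/-- The preimage of a closed subspace under U(g) is a closed subspace, so checking generators is
enough. -/
theorem op_mem_generated {O O' : Opens G} {g : G} (hO : ∀ x ∈ O, g * x ∈ O') {v : H}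
    (hv : v ∈ generated U V V' W O) : U.op g v ∈ generated U V V' W O' := by
  let K : Submodule ℝ H :=
    (generated U V V' W O').toSubmodule.comap ((U.op g).toLinearEquiv : H →ₗ[ℝ] H)
  have hK : IsClosed (K : Set H) :=
    (generated U V V' W O').isClosed.preimage (U.op g).continuous
  refine generated_le hK ?_ hv
  rintro v (⟨k, hk, hv⟩ | ⟨k, hk, hv⟩)
  · refine mem_generated (Or.inl ⟨g * k, hO k hk, ?_⟩)
    change U.op (g * k)⁻¹ (U.op g v) ∈ V'
    rwa [← U.op_mul, mul_inv_rev, inv_mul_cancel_right]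
  · refine mem_generated (Or.inr ⟨g * k, fun x hx => ?_, ?_⟩)
    · rw [mul_assoc]
      exact hO _ (hk x hx)
    · change U.op (g * k)⁻¹ (U.op g v) ∈ V
      rwa [← U.op_mul, mul_inv_rev, inv_mul_cancel_right]

theorem generated_covariant : (generated U V V' W).Covariant U := by
  intro g O O' hO
  have h1 : ∀ x ∈ O, g * x ∈ O' := fun x hx => by
    change g * x ∈ (O' : Set G)
    rw [hO]
    exact ⟨x, hx, rfl⟩
  have h2 : ∀ x ∈ O', g⁻¹ * x ∈ O := fun x hx => by
    change x ∈ (O' : Set G) at hx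
    rw [hO] at hx
    obtain ⟨y, hy, rfl⟩ := hx
    simpa using hy
  refine le_antisymm ?_ fun v hv => U.mem_translate.2 (op_mem_generated h2 hv)
  rintro _ ⟨v, hv, rfl⟩
  exact op_mem_generated h1 hv

theorem generated_reehSchlieder (hV' : IsCyclicSubspace V') :
    (generated U V V' W).ReehSchlieder := by
  rintro O ⟨g, hg⟩
  exact (hV'.translate U g).mono fun v hv =>
    mem_generated (Or.inl ⟨g, hg, U.mem_translate.1 hv⟩)

/-- The hypotheses treat the two kinds of generators: `h1` puts translates of V' at points of O
inside V, and `h2` leaves only g = 1 among the translates of W = O inside O. -/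
theorem generated_eq (hV : IsClosed (V : Set H)) {O : Opens G} (hOW : W = O)
    (h1 : ∀ g ∈ O, ∀ v, U.op g⁻¹ v ∈ V' → v ∈ V) (h2 : ∀ g : G, (∀ x ∈ O, g * x ∈ O) → g = 1) :
    (generated U V V' W O).toSubmodule = V := by
  refine le_antisymm (generated_le hV ?_) fun v hv => mem_generated (Or.inr ⟨1, ?_, ?_⟩)
  · rintro v (⟨g, hg, hv⟩ | ⟨g, hg, hv⟩)
    · exact h1 g hg v hv
    · rw [hOW] at hg
      rw [h2 g hg, inv_one, U.op_one] at hv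
      exact hv
  · rw [hOW]
    intro x hx
    rwa [one_mul]
  · rwa [inv_one, U.op_one]

end RealNet

end Nets

/-! ### Construction of a net from regularity. -/

section Regular

open Filter Topology

variable {E : Type*} [NormedAddCommGroup E] [NormedSpace ℝ E] [FiniteDimensional ℝ E]
  {G : Type*} [TopologicalSpace G] [ChartedSpace E G] [Group G] [LieGroup 𝓘(ℝ, E) ∞ G]
  [T2Space G] {τ : MulAut G} {H : Type*} [NormedAddCommGroup H] [InnerProductSpace ℂ H]
  [CompleteSpace H] {U : AntiunitaryRep τ H} {h : GroupLieAlgebra 𝓘(ℝ, E) G}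

theorem AntiunitaryRep.IsRegular.exists_realNet (hU : U.IsRegular h)
    (hτ : IntegratesEulerInvolution h τ) :
    ∃ N : RealNet G H, N.Isotone ∧ N.Covariant U ∧ N.ReehSchlieder ∧
      ∃ W : Opens G, IsConnected (W : Set G) ∧ (N W).toSubmodule = U.standardSubspace h := by
  have : IsTopologicalGroup G := topologicalGroup_of_lieGroup 𝓘(ℝ, E) ∞
  have : LocallyConnectedSpace G := ChartedSpace.locallyConnectedSpace E G
  obtain ⟨N, hN, hc⟩ := hU
  obtain ⟨N₀, hN₀, hpow⟩ := exists_nhds_one_forall_pow_mem_imp E (G := G)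
  have hinv : Tendsto (fun g : G => g⁻¹) (𝓝 1) (𝓝 1) := by
    simpa using (continuous_inv (G := G)).tendsto 1
  -- For g in W, membership of g⁻¹ in N gives U(g)V_N ⊆ V. As 1 lies in W, gW ⊆ W puts all powers of
  -- g in W ⊆ N₀, forcing g = 1.
  obtain ⟨W, hWN, hW, h1W, hWc⟩ := locallyConnectedSpace_iff_subsets_isOpen_isConnected.1 this 1 _
    (inter_mem (hinv hN) hN₀)
  refine ⟨RealNet.generated U (U.standardSubspace h) _ W, RealNet.generated_isotone,
    RealNet.generated_covariant, RealNet.generated_reehSchlieder hc, ⟨W, hW⟩, hWc,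
    RealNet.generated_eq (U.isFixedSpace hτ).isClosed rfl ?_ ?_⟩
  · intro g hg v hv
    have h1 := U.mem_iInf_translate.1 hv g⁻¹ (hWN hg).1
    rwa [inv_inv, U.op_op_inv] at h1
  · intro g hg
    refine hpow g fun n => (hWN ?_).2
    induction n with
    | zero => rwa [pow_zero]
    | succ n ih =>
      rw [pow_succ']
      exact hg _ ih

end Regular

/-! ### The equivalence of the three conditions. -/

theorem mainTheorem3
    {E : Type*} [NormedAddCommGroup E] [NormedSpace ℝ E] [FiniteDimensional ℝ E]
    {G : Type*} [TopologicalSpace G] [T2Space G] [ChartedSpace E G] [Group G]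
    [LieGroup 𝓘(ℝ, E) ∞ G] [ConnectedSpace G]
    (h : GroupLieAlgebra 𝓘(ℝ, E) G) (hh : IsEulerElement h)
    (τ : MulAut G) (hτ : IntegratesEulerInvolution h τ)
    {H : Type*} [NormedAddCommGroup H] [InnerProductSpace ℂ H] [CompleteSpace H]
    (U : AntiunitaryRep τ H) :
    List.TFAE [
      ∃ N : RealNet G H, N.Isotone ∧ N.Covariant U ∧ N.ReehSchlieder ∧
        ∃ W : Opens G, N.BisognanoWichmann U h W,
      ∃ N : RealNet G H, N.Isotone ∧ N.Covariant U ∧ N.ReehSchlieder ∧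
        ∃ W : Opens G, IsConnected (W : Set G) ∧ (N W).toSubmodule = U.standardSubspace h,
      U.IsRegular h] := by
  have : IsTopologicalGroup G := topologicalGroup_of_lieGroup 𝓘(ℝ, E) ∞
  have hV := U.isFixedSpace hτ
  tfae_have 1 → 3 := by
    rintro ⟨N, hiso, hcov, hRS, W, hW, ⟨hcl, -, hsep⟩, hΔ⟩
    obtain ⟨M, hM, hc⟩ := N.exists_isCyclicSubspace_iInf_translate U hiso hcov hRS hW.nonempty
    exact U.isRegular_of_isCyclicSubspace hh hτ
      (fun v hv => (U.isUnitaryOneParam h).exists_mem_imaginaryExpGraph hcl hsep hΔ hv) hM hc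
  tfae_have 3 → 2 := fun hU => hU.exists_realNet hτ
  tfae_have 2 → 1 := by
    rintro ⟨N, hiso, hcov, hRS, W, hW, hNW⟩
    -- Cyclicity of H(W) comes from (RS); the separating property and the modular operator come from
    -- H(W) = V.
    refine ⟨N, hiso, hcov, hRS, W, hW, ⟨(N W).isClosed, hRS W hW.nonempty, ?_⟩, ?_⟩
    · rw [hNW]
      exact hV.isSeparatingSubspace
    · rw [hNW]
      exact hV.modularOperatorGraph_eq
  tfae_finish
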